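/- **Conventions.** Let $V$ be a finite set, $\mathbb K$ a field, $R=\mathbb K[x_v : v\in V]$, and let $\Delta$ be a simplicial complex on $V$ (the empty face plays no role: facets are maximal nonempty faces, the complex without facets is allowed, and not every element of $V$ has to be a vertex of $\Delta$). Let $\mathcal F(\Delta)$ be the set of facets of $\Delta$. For $S\subseteq V$ put $\mathbf x_S=\prod_{v\in S}x_v$, and let $I(\Delta)=\langle \mathbf x_F : F\in\mathcal F(\Delta)\rangle\subseteq R$ be the facet ideal. A subcomplex of $\Delta$ means a complex $\Gamma$ with $\mathcal F(\Gamma)\subseteq\mathcal F(\Delta)$. A facet $F$ of $\Delta$ is a leaf if it is the only facet, or if there is a facet $G\ne F$ with $F\cap H\subseteq F\cap G$ for all facets $H\neq F$. A simplicial complex is connected if any two facets are joined by a chain of facets in which consecutive ones intersect; a connected complex is a simplicial tree if each of its subcomplexes with at least one facet has a leaf; $\Delta$ is a simplicial forest if every connected component of it is a simplicial tree. A simplicial forest $\Delta$ is Cohen–Macaulay (over $\mathbb K$) if $R/I(\Delta)$ is Cohen–Macaulay, i.e. $\operatorname{depth}(R/I(\Delta))=\dim (R/I(\Delta))$, where depth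 is taken with respect to the graded maximal ideal of $R$. The matching number $\nu(\Delta)$ is the maximal number of pairwise disjoint facets of $\Delta$. For a square-free monomial ideal $I$ and $k\ge 0$, the $k$-th square-free power $I^{[k]}$ is the ideal generated by the square-free monomials in $I^k$; in particular $I^{[0]}=R$. For a facet $F$ let $\mathcal N_\Delta[F]=\{F\}\cup\{H\in\mathcal F(\Delta): H\cap F\ne\emptyset\}$. **Lemma (colon lemma).** Let $\Delta$ be a Cohen–Macaulay simplicial forest, let $F$ be a leaf of $\Delta$, and let $\Delta_1$ be the subcomplex of $\Delta$ with $\mathcal F(\Delta_1)=\mathcal F(\Delta)\setminus\mathcal N_\Delta[F]$. Then for all $1\le k\le\nu(\Delta)$, $$\bigl(I(\Delta)^{[k]}:\mathbf x_F\bigr)=I(\Delta_1)^{[k-1]}$$ as ideals of $R$. Moreover, $\Delta_1$ is also a Cohen–Macaulay simplicial forest. -/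

import Mathlib

namespace FacetComplex

/-- The facets of a simplicial complex: its maximal faces. (The faces of a
`PreAbstractSimplicialComplex` are its nonempty faces; the empty face is left implicit. The
elements of `V` need not all be vertices of the complex.) -/
def facets {V : Type*} (D : PreAbstractSimplicialComplex V) : Set (Finset V) :=
  {F | Maximal (fun s => s ∈ D.faces) F}

/-- `⟨F : F ∈ S⟩`: the complex of all nonempty subsets of members of `S`. -/
def generated {V : Type*} (S : Set (Finset V)) : PreAbstractSimplicialComplex V where
  faces := {s | s.Nonempty ∧ ∃ F ∈ S, s ⊆ F}
  isRelLowerSet_faces := by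
    rintro s ⟨hs, F, hF, hsF⟩
    exact ⟨hs, fun t hts ht => ⟨ht, F, hF, hts.trans hsF⟩⟩

/-- `G` is a subcomplex of `D` in the sense used for facet ideals: its facets are facets of `D`. -/
def IsSubcomplex {V : Type*} (G D : PreAbstractSimplicialComplex V) : Prop :=
  facets G ⊆ facets D

/-- The facet `F` is a leaf: it is the only facet, or there is a facet `G ≠ F` (a joint of `F`)
with `F ∩ H ⊆ F ∩ G` for all facets `H ≠ F`. -/
def IsLeaf {V : Type*} [DecidableEq V] (D : PreAbstractSimplicialComplex V) (F : Finset V) :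
    Prop :=
  F ∈ facets D ∧
    (facets D = {F} ∨
      ∃ G ∈ facets D, G ≠ F ∧ ∀ H ∈ facets D, H ≠ F → F ∩ H ⊆ F ∩ G)

/-- Any two facets are joined by a chain of facets in which consecutive ones intersect. -/
def IsConnected {V : Type*} [DecidableEq V] (D : PreAbstractSimplicialComplex V) : Prop :=
  ∀ F ∈ facets D, ∀ G ∈ facets D,
    Relation.ReflTransGen (fun A B => B ∈ facets D ∧ (A ∩ B).Nonempty) F G

/-- A connected component: a maximal nonempty connected subcomplex. -/
def IsComponent {V : Type*} [DecidableEq V] (G D : PreAbstractSimplicialComplex V) : Prop :=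
  Maximal (fun C => IsSubcomplex C D ∧ (facets C).Nonempty ∧ IsConnected C) G

/-- A simplicial tree: connected, and every nonempty subcomplex has a leaf. -/
def IsTree {V : Type*} [DecidableEq V] (D : PreAbstractSimplicialComplex V) : Prop :=
  IsConnected D ∧ ∀ G, IsSubcomplex G D → (facets G).Nonempty → ∃ F, IsLeaf G F

/-- A simplicial forest: every connected component is a simplicial tree. -/
def IsForest {V : Type*} [DecidableEq V] (D : PreAbstractSimplicialComplex V) : Prop :=
  ∀ G, IsComponent G D → IsTree G

/-- The closed neighborhood `N[F]`: `F` together with all facets that meet `F`. -/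
def closedNeighborhood {V : Type*} [DecidableEq V] (D : PreAbstractSimplicialComplex V)
    (F : Finset V) : Set (Finset V) :=
  {H | H = F ∨ (H ∈ facets D ∧ (H ∩ F).Nonempty)}

/-- The subcomplex whose facets are the facets of `D` outside `N[F]`. -/
def deleteClosedNeighborhood {V : Type*} [DecidableEq V] (D : PreAbstractSimplicialComplex V)
    (F : Finset V) : PreAbstractSimplicialComplex V :=
  generated (facets D \ closedNeighborhood D F)

theorem facets_deleteClosedNeighborhood {V : Type*} [DecidableEq V]
    (D : PreAbstractSimplicialComplex V) (F : Finset V) :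
    facets (deleteClosedNeighborhood D F) = facets D \ closedNeighborhood D F := by
  ext A
  constructor
  · rintro ⟨⟨hA, B, hB, hAB⟩, hmax⟩
    have hBne : B.Nonempty := hA.mono hAB
    have : B ⊆ A := hmax (y := B) ⟨hBne, B, hB, subset_rfl⟩ hAB
    rwa [Finset.Subset.antisymm hAB this]
  · intro hA
    refine ⟨⟨(D.isRelLowerSet_faces hA.1.1).1, A, hA, subset_rfl⟩, ?_⟩
    rintro B ⟨_, C, hC, hBC⟩ hAB
    exact hBC.trans (hA.1.2 hC.1.1 (le_trans hAB hBC))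

/-- The matching number: the largest number of pairwise disjoint facets. -/
noncomputable def matchingNumber {V : Type*} (D : PreAbstractSimplicialComplex V) : ℕ :=
  sSup {n | ∃ M : Finset (Finset V), (M : Set (Finset V)) ⊆ facets D ∧
    (M : Set (Finset V)).PairwiseDisjoint id ∧ M.card = n}

/-- The square-free monomial `x_S`, the product of the variables in `S`. -/
noncomputable def monomialOf {V : Type*} (K : Type*) [Field K] (S : Finset V) :
    MvPolynomial V K :=
  ∏ v ∈ S, MvPolynomial.X v

/-- The facet ideal `I(D)`, generated by the `x_F` for the facets `F`. -/
noncomputable def facetIdeal {V : Type*} (K : Type*) [Field K]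
    (D : PreAbstractSimplicialComplex V) : Ideal (MvPolynomial V K) :=
  Ideal.span (monomialOf K '' facets D)

/-- The `k`-th square-free power `I^[k]`, generated by the square-free monomials in `I ^ k`;
for `k = 0` it is the whole ring. -/
noncomputable def squarefreePower {V K : Type*} [Field K] (I : Ideal (MvPolynomial V K))
    (k : ℕ) : Ideal (MvPolynomial V K) :=
  Ideal.span {p | p ∈ I ^ k ∧ ∃ S : Finset V, p = monomialOf K S}

/-- The depth of `R ⧸ I`: the supremum of the lengths of the `R ⧸ I`-regular sequences in the
graded maximal ideal of the polynomial ring `R`. -/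
noncomputable def depthQuotient {V K : Type*} [Field K] (I : Ideal (MvPolynomial V K)) :
    WithBot ℕ∞ :=
  ⨆ rs ∈ {rs : List (MvPolynomial V K) | (∀ r ∈ rs, r ∈ MvPolynomial.idealOfVars V K) ∧
    RingTheory.Sequence.IsRegular (MvPolynomial V K ⧸ I) rs}, ((rs.length : ℕ∞) : WithBot ℕ∞)

/-- For a homogeneous ideal `I`, the graded ring `R ⧸ I` is Cohen-Macaulay: its depth equals its
Krull dimension. -/
def IsCohenMacaulayQuotient {V K : Type*} [Field K] (I : Ideal (MvPolynomial V K)) : Prop :=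
  depthQuotient I = ringKrullDim (MvPolynomial V K ⧸ I)

/-- A Cohen-Macaulay simplicial forest (over `K`): a simplicial forest `D` for which the quotient
of the polynomial ring by the facet ideal is Cohen-Macaulay. (Variables outside the vertex set of
`D` raise depth and dimension equally, so they do not matter.) -/
def IsCohenMacaulayForest {V : Type*} [DecidableEq V] (K : Type*) [Field K]
    (D : PreAbstractSimplicialComplex V) : Prop :=
  IsForest D ∧ IsCohenMacaulayQuotient (facetIdeal K D)

end FacetComplex

/-!
Induction on leaves gives a König theorem: a simplicial forest has a matching `L` and a vertex cover
of the same size. If the quotient by the facet ideal is Cohen–Macaulay, then it is unmixed, so that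
every minimal vertex cover has the size of `L` and meets each member of `L` exactly once.
Together with the absence of cycles this makes the forest a grafting in the sense of Faridi: `L`
covers all vertices, and the traces of the facets on each member of `L` form a chain.

Conversely, on each member of a grafting the square-free monomials look like the polarization of
powers of a single variable. Undoing this polarization produces a regular sequence of linear forms
as long as the dimension, so graftings are Cohen–Macaulay. Removing the closed neighbourhood of a
member of `L` leaves a grafting, and every leaf belongs to `L`. Since the traces on a leaf `F` form
a chain, a matching has at most one member that meets `F`; this is the colon formula.
-/

section AssociatedPrimes

variable {R M : Type*} [CommRing R] [AddCommGroup M] [Module R M]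

theorem ringKrullDim_quotient_add_one_le_of_mem {P Q : Ideal R} [P.IsPrime] {x : R} (hPQ : P ≤ Q)
    (hxP : x ∉ P) (hxQ : x ∈ Q) : ringKrullDim (R ⧸ Q) + 1 ≤ ringKrullDim (R ⧸ P) := by
  have hx : Ideal.Quotient.mk P x ∈ nonZeroDivisors (R ⧸ P) := by
    rwa [mem_nonZeroDivisors_iff_ne_zero, Ne, Ideal.Quotient.eq_zero_iff_mem]
  have hker : Ideal.span {Ideal.Quotient.mk P x} ≤ RingHom.ker (Ideal.Quotient.factor hPQ) := by
    rw [Ideal.span_singleton_le_iff_mem, RingHom.mem_ker, Ideal.Quotient.factor_mk]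
    exact Ideal.Quotient.eq_zero_iff_mem.2 hxQ
  calc ringKrullDim (R ⧸ Q) + 1
      ≤ ringKrullDim ((R ⧸ P) ⧸ Ideal.span {Ideal.Quotient.mk P x}) + 1 := by
        gcongr
        exact ringKrullDim_le_of_surjective _ (Ideal.Quotient.lift_surjective_of_surjective _ hker
          (Ideal.Quotient.factor_surjective hPQ))
    _ ≤ ringKrullDim (R ⧸ P) := ringKrullDim_quotient_succ_le_of_nonZeroDivisor hx

theorem injective_quotSMulTop_map_subtype_torsionBySet {x : R} (hx : IsSMulRegular M x)
    (s : Set R) :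
    Function.Injective (QuotSMulTop.map x (Submodule.torsionBySet R M s).subtype) := by
  rw [injective_iff_map_eq_zero]
  intro q hq
  obtain ⟨n, rfl⟩ := Submodule.Quotient.mk_surjective _ q
  rw [QuotSMulTop.map_apply_mk, Submodule.Quotient.mk_eq_zero,
    Submodule.mem_smul_pointwise_iff_exists] at hq
  obtain ⟨y, -, hy⟩ := hq
  have hy' : y ∈ Submodule.torsionBySet R M s := by
    rw [Submodule.mem_torsionBySet_iff]
    intro a
    have hn : (a : R) • x • y = 0 := by
      rw [hy]
      exact (Submodule.mem_torsionBySet_iff _ _).1 n.2 a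
    exact hx.right_eq_zero_of_smul (by rwa [smul_comm])
  rw [Submodule.Quotient.mk_eq_zero, Submodule.mem_smul_pointwise_iff_exists]
  exact ⟨⟨y, hy'⟩, trivial, Subtype.ext hy⟩

/- The submodule `N` of elements killed by `P` satisfies `N / x N ⊆ M / x M`, and `m` lies in the
support of `N / x N`. -/
theorem exists_mem_associatedPrimes_quotSMulTop [IsNoetherianRing R] [Module.Finite R M]
    {m P : Ideal R} [m.IsPrime] (hP : P ∈ associatedPrimes R M) (hPm : P ≤ m) {x : R}
    (hx : IsSMulRegular M x) (hxm : x ∈ m) :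
    ∃ Q ∈ associatedPrimes R (QuotSMulTop x M), P ≤ Q ∧ x ∈ Q ∧ Q ≤ m := by
  obtain ⟨-, u, hu⟩ := isAssociatedPrime_iff.1 hP
  have hu' (r : R) : r ∈ P ↔ r • u = 0 := by
    rw [hu, Submodule.mem_colon_singleton, Submodule.mem_bot]
  set N := Submodule.torsionBySet R M (P : Set R)
  have hPN : P ≤ Module.annihilator R N := fun r hr ↦
    Module.mem_annihilator.2 fun n ↦
      Subtype.ext <| (Submodule.mem_torsionBySet_iff _ _).1 n.2 ⟨r, hr⟩
  have hNm : Module.annihilator R N ≤ m := fun r hr ↦ hPm <| (hu' r).2 <|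
    congrArg Subtype.val <| Module.mem_annihilator.1 hr
      ⟨u, (Submodule.mem_torsionBySet_iff _ _).2 fun a ↦ (hu' _).1 a.2⟩
  have hm : (⟨m, ‹_›⟩ : PrimeSpectrum R) ∈ Module.support R (QuotSMulTop x N) := by
    rw [Module.support_quotSMulTop, Module.support_eq_zeroLocus]
    exact ⟨hNm, Set.singleton_subset_iff.2 hxm⟩
  obtain ⟨Q, hQ, hQm⟩ := Ideal.exists_minimalPrimes_le (Module.annihilator_le_of_mem_support hm)
  refine ⟨Q, ?_, ?_, hQ.1.2 (QuotSMulTop.mem_annihilator N x), hQm⟩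
  · exact associatedPrimes.subset_of_injective
      (injective_quotSMulTop_map_subtype_torsionBySet hx P)
      (Module.associatedPrimes.minimalPrimes_annihilator_subset_associatedPrimes R _ hQ)
  · exact hPN.trans <| (LinearMap.annihilator_le_of_surjective _
      (Submodule.mkQ_surjective _)).trans hQ.1.2

theorem notMem_of_mem_associatedPrimes [IsNoetherianRing R] {P : Ideal R}
    (hP : P ∈ associatedPrimes R M) {x : R} (hx : IsSMulRegular M x) : x ∉ P := fun hxP ↦ by
  have hx' := Set.mem_biUnion hP hxP
  rw [biUnion_associatedPrimes_eq_compl_regular] at hx'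
  exact hx' hx

theorem length_le_ringKrullDim_quotient_of_mem_associatedPrimes [IsNoetherianRing R]
    {m : Ideal R} [m.IsPrime] (rs : List R) (hm : ∀ r ∈ rs, r ∈ m) :
    ∀ (M : Type*) [AddCommGroup M] [Module R M] [Module.Finite R M] (P : Ideal R),
      P ∈ associatedPrimes R M → P ≤ m → RingTheory.Sequence.IsWeaklyRegular M rs →
      ((rs.length : ℕ∞) : WithBot ℕ∞) ≤ ringKrullDim (R ⧸ P) := by
  induction rs with
  | nil =>
    intro M _ _ _ P hP _ _
    have := hP.isPrime
    simpa using ringKrullDim_nonneg_of_nontrivial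
  | cons x rs ih =>
    intro M _ _ _ P hP hPm hrs
    obtain ⟨hx, hrs⟩ := (RingTheory.Sequence.isWeaklyRegular_cons_iff M x rs).1 hrs
    rw [List.forall_mem_cons] at hm
    obtain ⟨Q, hQ, hPQ, hxQ, hQm⟩ := exists_mem_associatedPrimes_quotSMulTop hP hPm hx hm.1
    have := hP.isPrime
    calc (((x :: rs).length : ℕ∞) : WithBot ℕ∞) = (rs.length : ℕ∞) + 1 := by simp
      _ ≤ ringKrullDim (R ⧸ Q) + 1 := by gcongr; exact ih hm.2 _ Q hQ hQm hrs
      _ ≤ ringKrullDim (R ⧸ P) :=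
        ringKrullDim_quotient_add_one_le_of_mem hPQ
          (notMem_of_mem_associatedPrimes hP hx) hxQ

theorem ringKrullDim_quotient_le_of_forall_prime {I : Ideal R} {d : WithBot ℕ∞}
    (h : ∀ Q : Ideal R, Q.IsPrime → I ≤ Q → ringKrullDim (R ⧸ Q) ≤ d) :
    ringKrullDim (R ⧸ I) ≤ d := by
  simp only [ringKrullDim_quotient] at h ⊢
  refine iSup_le fun p ↦ ?_
  refine le_trans ?_ (h p.head.1.asIdeal p.head.1.isPrime p.head.2)
  let q : LTSeries (PrimeSpectrum.zeroLocus (p.head.1.asIdeal : Set R)) :=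
    { length := p.length
      toFun := fun i ↦ ⟨(p i).1, LTSeries.head_le p i⟩
      step := p.step }
  exact Order.LTSeries.length_le_krullDim q

end AssociatedPrimes

theorem comap_map_eq_ker_sup {A F : Type*} [CommRing A] [FunLike F A A] [RingHomClass F A A]
    (φ : F) (hφ : ∀ f, φ (φ f) = φ f) (I : Ideal A) :
    (I.map φ).comap φ = RingHom.ker φ ⊔ I := by
  have hmap : I.map φ ≤ RingHom.ker φ ⊔ I := Ideal.map_le_iff_le_comap.2 fun f hf ↦ by
    have : φ f = (φ f - f) + f := by ring
    rw [Ideal.mem_comap, this]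
    exact Submodule.add_mem_sup (by simp [RingHom.mem_ker, hφ]) hf
  refine le_antisymm (fun f hf ↦ ?_) (sup_le (Ideal.ker_le_comap φ) Ideal.le_comap_map)
  have : f = (f - φ f) + φ f := by ring
  rw [this]
  exact add_mem (Ideal.mem_sup_left (by simp [RingHom.mem_ker, hφ])) (hmap hf)

theorem add_single_notMem_upperClosure {σ : Type*} {S : Set (σ →₀ ℕ)} {a b : σ} (hab : a ≠ b)
    (hb : ∀ s ∈ S, s b ≤ 1) (ha : ∀ s ∈ S, s b ≠ 0 → ∀ t ∈ S, t a ≤ s a) {u : σ →₀ ℕ}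
    (hu : u ∉ upperClosure S) (hub : u + Finsupp.single b 1 ∈ upperClosure S) :
    u b = 0 ∧ u + Finsupp.single a 1 ∉ upperClosure S := by
  classical
  obtain ⟨s, hs, hsu⟩ := hub
  have hle {t : σ →₀ ℕ} {x : σ} (htu : t ≤ u + Finsupp.single x 1) (htx : t x ≤ u x) :
      t ≤ u := fun y ↦ by
    rcases eq_or_ne x y with rfl | hy
    · exact htx
    · simpa [Finsupp.single_apply, hy] using htu y
  have hsb : u b < s b := lt_of_not_ge fun h ↦ hu ⟨s, hs, hle hsu h⟩
  refine ⟨by have := hb s hs; lia, fun ⟨t, ht, htu⟩ ↦ hu ⟨t, ht, hle htu ?_⟩⟩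
  have hsa : s a ≤ u a := by simpa [hab.symm] using hsu a
  exact (ha s hs (by lia) t ht).trans hsa

section MonomialIdeals

open MvPolynomial

variable {σ R : Type*} [CommRing R]

/- Polarization: `b` plays the part of the last new variable introduced for `a`. Let `u`
have maximal `b`-degree among the exponents outside the ideal of a polynomial `g`; then `u * x_b` or
`u * x_a` is outside the ideal, and it occurs in `(x_b - x_a) * g` without cancellation. -/
theorem isSMulRegular_X_sub_X_quotient {S : Set (σ →₀ ℕ)} {a b : σ} (hab : a ≠ b)
    (hb : ∀ s ∈ S, s b ≤ 1) (ha : ∀ s ∈ S, s b ≠ 0 → ∀ t ∈ S, t a ≤ s a) :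
    IsSMulRegular (MvPolynomial σ R ⧸ Ideal.span ((fun s ↦ monomial s (1 : R)) '' S))
      (X b - X a : MvPolynomial σ R) := by
  classical
  rw [isSMulRegular_quotient_iff_mem_of_smul_mem]
  intro g hg
  simp only [smul_eq_mul, mem_ideal_span_monomial_image, ← mem_upperClosure] at hg ⊢
  have hcoeff (n : σ →₀ ℕ) (hn : n ∉ upperClosure S) :
      coeff n (X b * g) = coeff n (X a * g) := by
    rw [← sub_eq_zero, ← coeff_sub, ← sub_mul]
    by_contra h
    exact hn (hg n (mem_support_iff.2 h))
  by_contra! hbad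
  obtain ⟨u, ⟨hug, huS⟩, hmax⟩ :=
    (g.support.finite_toSet.sep (· ∉ upperClosure S)).exists_maximalFor (fun u ↦ u b) _ hbad
  have hub : u + Finsupp.single b 1 ∈ upperClosure S := by
    by_contra hub
    have h := hcoeff _ hub
    rw [add_comm, coeff_X_mul, coeff_X_mul'] at h
    split_ifs at h
    · have hw := hmax ⟨mem_support_iff.2 (h ▸ mem_support_iff.1 hug), fun hmem ↦
        hub ((upperClosure S).upper (tsub_le_self.trans_eq (add_comm _ _)) hmem)⟩
      simp [hab] at hw
    · exact mem_support_iff.1 hug h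
  obtain ⟨hub0, hua⟩ := add_single_notMem_upperClosure hab hb ha huS hub
  have h := hcoeff _ hua
  rw [add_comm, coeff_X_mul, coeff_X_mul', if_neg (by simp [hub0, hab])] at h
  exact mem_support_iff.1 hug h.symm

theorem isSMulRegular_X_quotient {S : Set (σ →₀ ℕ)} {b : σ} (hS : ∀ s ∈ S, s b = 0) :
    IsSMulRegular (MvPolynomial σ R ⧸ Ideal.span ((fun s ↦ monomial s (1 : R)) '' S))
      (X b : MvPolynomial σ R) := by
  rw [isSMulRegular_quotient_iff_mem_of_smul_mem]
  intro g hg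
  rw [mem_ideal_span_monomial_image] at hg ⊢
  intro u hu
  obtain ⟨s, hs, hsu⟩ := hg (Finsupp.single b 1 + u) <| by
    rwa [smul_eq_mul, mem_support_iff, coeff_X_mul, ← mem_support_iff]
  refine ⟨s, hs, fun x ↦ ?_⟩
  rcases eq_or_ne b x with rfl | hx
  · simp [hS s hs]
  · simpa [Finsupp.single_apply, hx] using hsu x

end MonomialIdeals

section Substitution

open MvPolynomial

variable {σ R : Type*} [CommRing R]

theorem sub_map_mem_span_X_sub (φ : MvPolynomial σ R →ₐ[R] MvPolynomial σ R) {B : Set σ}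
    (hφ : ∀ v ∉ B, φ (X v) = X v) (f : MvPolynomial σ R) :
    f - φ f ∈ Ideal.span ((fun v ↦ X v - φ (X v)) '' B) := by
  set E := Ideal.span ((fun v ↦ X v - φ (X v)) '' B)
  have h : (Ideal.Quotient.mkₐ R E).comp φ = Ideal.Quotient.mkₐ R E := by
    ext v
    by_cases hv : v ∈ B
    · have hvE : X v - φ (X v) ∈ E := Ideal.subset_span (Set.mem_image_of_mem _ hv)
      exact (Ideal.Quotient.eq.2 hvE).symm
    · rw [AlgHom.comp_apply, hφ v hv]
  exact Ideal.Quotient.eq.1 (DFunLike.congr_fun h f).symm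

theorem ker_eq_span_X_sub {φ : MvPolynomial σ R →ₐ[R] MvPolynomial σ R} {B : Set σ}
    (hφ : ∀ v ∉ B, φ (X v) = X v) (hidem : ∀ f, φ (φ f) = φ f) :
    RingHom.ker φ = Ideal.span ((fun v ↦ X v - φ (X v)) '' B) := by
  refine le_antisymm (fun f hf ↦ ?_) (Ideal.span_le.2 ?_)
  · simpa [RingHom.mem_ker.1 hf] using sub_map_mem_span_X_sub φ hφ f
  · rintro _ ⟨v, -, rfl⟩
    simp [hidem]

end Substitution

section SpanX

open MvPolynomial

variable {σ R : Type*} [CommRing R]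

theorem ker_killCompl_compl (C : Set σ) :
    RingHom.ker (killCompl (R := R) (Subtype.val_injective (p := (· ∈ Cᶜ)))) =
      Ideal.span (X '' C) := by
  refine le_antisymm (fun f hf ↦ mem_ideal_span_X_image.2 fun m hm ↦ ?_) (Ideal.span_le.2 ?_)
  · by_contra! hmC
    rw [← m.mapDomain_comapDomain _ Subtype.val_injective fun v hv ↦
      ⟨⟨v, fun hvC ↦ Finsupp.mem_support_iff.1 hv (hmC v hvC)⟩, rfl⟩, mem_support_iff,
      ← coeff_killCompl Subtype.val_injective, RingHom.mem_ker.1 hf] at hm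
    exact hm rfl
  · rintro _ ⟨v, hv, rfl⟩
    exact killCompl_monomial_eq_zero_of_notMem_range Subtype.val_injective 1
      (a := v) (by simp) (by simpa using hv)

theorem isPrime_span_X_image [IsDomain R] (C : Set σ) :
    (Ideal.span (X '' C) : Ideal (MvPolynomial σ R)).IsPrime := by
  rw [← ker_killCompl_compl]
  exact RingHom.ker_isPrime _

theorem ringKrullDim_quotient_span_X_image [IsNoetherianRing R] [Finite σ] (C : Set σ) :
    ringKrullDim (MvPolynomial σ R ⧸ (Ideal.span (X '' C) : Ideal (MvPolynomial σ R))) =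
      ringKrullDim R + Cᶜ.ncard := by
  rw [← ker_killCompl_compl, ringKrullDim_eq_of_ringEquiv
    (Ideal.quotientKerAlgEquivOfSurjective fun f ↦
      ⟨_, killCompl_rename_app Subtype.val_injective f⟩).toRingEquiv,
    MvPolynomial.ringKrullDim_of_isNoetherianRing, Nat.card_coe_set_eq]

end SpanX

section RegularSequences

variable {A : Type*} [CommRing A] {I : Ideal A}

theorem mk_mem_smul_top_quotient_iff {J : Ideal A} {f : A} :
    Ideal.Quotient.mk I f ∈ (J • ⊤ : Submodule A (A ⧸ I)) ↔ f ∈ J ⊔ I := by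
  rw [Ideal.smul_top_eq_map, Submodule.restrictScalars_mem]
  exact Ideal.mem_quotient_iff_mem_sup

theorem isWeaklyRegular_quotient_concat_iff {rs : List A} {x : A} :
    RingTheory.Sequence.IsWeaklyRegular (A ⧸ I) (rs ++ [x]) ↔
      RingTheory.Sequence.IsWeaklyRegular (A ⧸ I) rs ∧
        IsSMulRegular (A ⧸ Ideal.ofList rs ⊔ I) x := by
  rw [RingTheory.Sequence.isWeaklyRegular_append_iff,
    RingTheory.Sequence.isWeaklyRegular_cons_iff]
  simp only [RingTheory.Sequence.IsWeaklyRegular.nil, and_true,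
    isSMulRegular_quotient_iff_mem_of_smul_mem, Ideal.Quotient.mk_surjective.forall,
    ← Ideal.Quotient.mk_eq_mk, ← Submodule.Quotient.mk_smul]
  simp only [Ideal.Quotient.mk_eq_mk, mk_mem_smul_top_quotient_iff]

theorem isRegular_quotient_of_sup_ne_top {rs : List A}
    (h : RingTheory.Sequence.IsWeaklyRegular (A ⧸ I) rs) (hne : Ideal.ofList rs ⊔ I ≠ ⊤) :
    RingTheory.Sequence.IsRegular (A ⧸ I) rs :=
  ⟨h, fun htop ↦ hne <| (Ideal.eq_top_iff_one _).2 <| mk_mem_smul_top_quotient_iff.1 <|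
    htop ▸ Submodule.mem_top⟩

theorem isSMulRegular_quotient_comap {B F : Type*} [CommRing B] [FunLike F A B]
    [RingHomClass F A B] (φ : F) {J : Ideal B} {x : A}
    (hx : IsSMulRegular (B ⧸ J) (φ x)) : IsSMulRegular (A ⧸ J.comap φ) x := by
  rw [isSMulRegular_quotient_iff_mem_of_smul_mem] at hx ⊢
  exact fun f hf ↦ hx _ (by simpa using hf)

end RegularSequences

namespace FacetComplex

section VertexCovers

variable {V : Type*} {S : Set (Finset V)} {M : Finset (Finset V)} {C : Finset V}

/-- `C` is a vertex cover of the family `S`: it meets every member of `S`. Minimal vertex covers are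
expressed by `Minimal (IsVertexCover S) C`. -/
def IsVertexCover (S : Set (Finset V)) (C : Finset V) : Prop :=
  ∀ H ∈ S, ∃ v ∈ H, v ∈ C

/-- `M` is a matching in the family `S`: a finite set of pairwise disjoint members of `S`. -/
structure IsMatching (S : Set (Finset V)) (M : Finset (Finset V)) : Prop where
  subset : (M : Set (Finset V)) ⊆ S
  pairwiseDisjoint : (M : Set (Finset V)).PairwiseDisjoint id

/-- The family `S` is unmixed: all its minimal vertex covers have the smallest possible
cardinality. -/
def IsUnmixed (S : Set (Finset V)) : Prop :=
  ∀ ⦃C C' : Finset V⦄, Minimal (IsVertexCover S) C → IsVertexCover S C' → C.card ≤ C'.card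

theorem IsMatching.mono {T : Set (Finset V)} (h : IsMatching S M) (hST : S ⊆ T) : IsMatching T M :=
  ⟨h.subset.trans hST, h.pairwiseDisjoint⟩

theorem IsMatching.eq_of_mem (hM : IsMatching S M) {A B : Finset V} (hA : A ∈ M) (hB : B ∈ M)
    {v : V} (hvA : v ∈ A) (hvB : v ∈ B) : A = B :=
  hM.pairwiseDisjoint.elim hA hB (Finset.not_disjoint_iff.2 ⟨v, hvA, hvB⟩)

theorem IsMatching.card_le (hM : IsMatching S M) (hC : IsVertexCover (M : Set (Finset V)) C) :
    M.card ≤ C.card :=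
  Finset.card_le_card_of_forall_subsingleton (fun F v ↦ v ∈ F)
    (fun F hF ↦ (hC F hF).imp fun _ h ↦ h.symm)
    fun _ _ _ hA _ hB ↦ hM.eq_of_mem hA.1 hB.1 hA.2 hB.2

theorem IsMatching.exists_mem_of_card_le (hM : IsMatching S M) (hC : IsVertexCover S C)
    (hcard : C.card ≤ M.card) {c : V} (hc : c ∈ C) : ∃ F ∈ M, c ∈ F := by
  classical
  by_contra! hcM
  refine (Finset.card_erase_lt_of_mem hc).not_ge (hcard.trans (hM.card_le fun F hF ↦ ?_))
  obtain ⟨v, hvF, hvC⟩ := hC F (hM.subset hF)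
  exact ⟨v, hvF, Finset.mem_erase.2 ⟨fun h ↦ hcM F hF (h ▸ hvF), hvC⟩⟩

theorem IsMatching.eq_of_mem_cover_of_card_le (hM : IsMatching S M) (hC : IsVertexCover S C)
    (hcard : C.card ≤ M.card) {F : Finset V} (hF : F ∈ M) {a b : V} (haF : a ∈ F) (haC : a ∈ C)
    (hbF : b ∈ F) (hbC : b ∈ C) : a = b := by
  classical
  by_contra hab
  refine (Finset.card_erase_lt_of_mem hbC).not_ge (hcard.trans (hM.card_le fun A hA ↦ ?_))
  obtain ⟨v, hvA, hvC⟩ := hC A (hM.subset hA)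
  rcases eq_or_ne v b with rfl | hvb
  · obtain rfl := hM.eq_of_mem hA hF hvA hbF
    exact ⟨a, haF, Finset.mem_erase.2 ⟨hab, haC⟩⟩
  · exact ⟨v, hvA, Finset.mem_erase.2 ⟨hvb, hvC⟩⟩

theorem exists_mem_forall_eq_of_minimal (hC : Minimal (IsVertexCover S) C) {c : V} (hc : c ∈ C) :
    ∃ H ∈ S, ∀ v ∈ H, v ∈ C → v = c := by
  classical
  by_contra! h
  refine Finset.notMem_erase c C (hC.2 (fun H hH ↦ ?_) (Finset.erase_subset c C) hc)
  obtain ⟨v, hvH, hvC, hvc⟩ := h H hH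
  exact ⟨v, hvH, Finset.mem_erase.2 ⟨hvc, hvC⟩⟩

theorem exists_minimal_isVertexCover_disjoint [Finite V] {T : Finset V} (hT : ∀ H ∈ S, ¬ H ⊆ T) :
    ∃ C, Minimal (IsVertexCover S) C ∧ Disjoint C T := by
  classical
  have := Fintype.ofFinite V
  obtain ⟨C, hCT, hC⟩ := exists_minimal_le_of_wellFoundedLT (IsVertexCover S) Tᶜ fun H hH ↦ by
    simpa using Finset.not_subset.1 (hT H hH)
  exact ⟨C, hC, Finset.subset_compl_iff_disjoint_right.1 hCT⟩

theorem IsMatching.exists_insert_of_disjoint {F : Finset V} (hM : IsMatching (S \ {F}) M)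
    (hC : IsVertexCover (S \ {F}) C) (hF : F ∈ S) (hne : F.Nonempty)
    (hdisj : ∀ H ∈ S, H ≠ F → Disjoint F H) (hcard : C.card ≤ M.card) :
    ∃ M C, IsMatching S M ∧ IsVertexCover S C ∧ C.card ≤ M.card := by
  classical
  obtain ⟨v, hv⟩ := hne
  have hFM : F ∉ M := fun h ↦ (hM.subset h).2 rfl
  refine ⟨insert F M, insert v C, ⟨?_, ?_⟩, fun H hH ↦ ?_, ?_⟩
  · rw [Finset.coe_insert]
    exact Set.insert_subset hF (hM.subset.trans Set.sdiff_subset)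
  · rw [Finset.coe_insert]
    exact hM.pairwiseDisjoint.insert fun H hH _ ↦ hdisj H (hM.subset hH).1 (hM.subset hH).2
  · rcases eq_or_ne H F with rfl | hHF
    · exact ⟨v, hv, Finset.mem_insert_self v C⟩
    · exact (hC H ⟨hH, hHF⟩).imp fun w hw ↦ ⟨hw.1, Finset.mem_insert_of_mem hw.2⟩
  · rw [Finset.card_insert_of_notMem hFM]
    exact (Finset.card_insert_le v C).trans (by gcongr)

theorem IsMatching.exists_mem_of_forall_minimal_card_le [Finite V] (hM : IsMatching S M)
    (hcard : ∀ C, Minimal (IsVertexCover S) C → C.card ≤ M.card) (hanti : IsAntichain (· ⊆ ·) S)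
    {H : Finset V} (hH : H ∈ S) {v : V} (hv : v ∈ H) : ∃ F ∈ M, v ∈ F := by
  classical
  obtain ⟨C, hC, hCH⟩ := exists_minimal_isVertexCover_disjoint (S := S) (T := H.erase v)
    fun A hA hAH ↦ by
      obtain rfl := hanti.eq hA hH (hAH.trans (Finset.erase_subset v H))
      exact Finset.notMem_erase v A (hAH hv)
  obtain ⟨w, hwH, hwC⟩ := hC.1 H hH
  obtain rfl : w = v := by
    by_contra hwv
    exact Finset.disjoint_left.1 hCH hwC (Finset.mem_erase.2 ⟨hwv, hwH⟩)
  exact hM.exists_mem_of_card_le hC.1 (hcard C hC) hwC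

end VertexCovers

section Leaves

variable {V : Type*} [DecidableEq V] {S T : Set (Finset V)} {F G : Finset V}

/-- `F` is a leaf of the family `S`; `IsLeaf D F` is this notion for the facets of `D`. -/
def IsLeafOf (S : Set (Finset V)) (F : Finset V) : Prop :=
  F ∈ S ∧ (S = {F} ∨ ∃ G ∈ S, G ≠ F ∧ ∀ H ∈ S, H ≠ F → F ∩ H ⊆ F ∩ G)

/-- Every nonempty subfamily of `S` has a leaf: the combinatorial form of being the facet family of
a simplicial forest. -/
def HasLeaves (S : Set (Finset V)) : Prop :=
  ∀ T ⊆ S, T.Nonempty → ∃ F, IsLeafOf T F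

theorem HasLeaves.mono (h : HasLeaves S) (hT : T ⊆ S) : HasLeaves T :=
  fun U hU ↦ h U (hU.trans hT)

theorem IsLeafOf.disjoint_or_exists_joint (hF : IsLeafOf S F) :
    (∀ H ∈ S, H ≠ F → Disjoint F H) ∨
      ∃ G ∈ S, G ≠ F ∧ ¬ Disjoint F G ∧ ∀ H ∈ S, H ≠ F → F ∩ H ⊆ G := by
  rcases hF.2 with hS | ⟨G, hG, hGF, hjoint⟩
  · exact .inl fun H hH hHF ↦ absurd (hS.subset hH) hHF
  · by_cases hFG : Disjoint F G
    · refine .inl fun H hH hHF ↦ ?_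
      rw [Finset.disjoint_iff_inter_eq_empty, ← Finset.subset_empty] at hFG ⊢
      exact (hjoint H hH hHF).trans hFG
    · exact .inr ⟨G, hG, hGF, hFG, fun H hH hHF ↦ (hjoint H hH hHF).trans Finset.inter_subset_right⟩

theorem IsLeafOf.of_disjoint (hF : IsLeafOf S F) (hST : S ⊆ T)
    (h : ∀ H ∈ T, H ∉ S → Disjoint F H) : IsLeafOf T F := by
  refine ⟨hST hF.1, or_iff_not_imp_left.2 fun hT ↦ ?_⟩
  have hsub (G H : Finset V) (hH : H ∈ T) (hHS : H ∉ S) : F ∩ H ⊆ F ∩ G := by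
    rw [Finset.disjoint_iff_inter_eq_empty.1 (h H hH hHS)]
    exact Finset.empty_subset _
  rcases hF.2 with rfl | ⟨G, hG, hGF, hjoint⟩
  · obtain ⟨G, hG, hGF⟩ : ∃ G ∈ T, G ≠ F := by
      by_contra! honly
      exact hT (Set.eq_singleton_iff_unique_mem.2 ⟨hST rfl, honly⟩)
    exact ⟨G, hG, hGF, fun H hH hHF ↦ hsub G H hH hHF⟩
  · refine ⟨G, hST hG, hGF, fun H hH hHF ↦ ?_⟩
    by_cases hHS : H ∈ S
    · exact hjoint H hHS hHF
    · exact hsub G H hH hHS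

theorem IsLeafOf.exists_free_vertex (hF : IsLeafOf S F) (hne : F.Nonempty)
    (hanti : IsAntichain (· ⊆ ·) S) : ∃ v ∈ F, ∀ H ∈ S, v ∈ H → H = F := by
  rcases hF.disjoint_or_exists_joint with hdisj | ⟨G, hG, hGF, -, hjoint⟩
  · obtain ⟨v, hv⟩ := hne
    exact ⟨v, hv, fun H hH hvH ↦
      not_imp_comm.1 (hdisj H hH) (Finset.not_disjoint_iff.2 ⟨v, hv, hvH⟩)⟩
  · obtain ⟨v, hvF, hvG⟩ := Finset.not_subset.1 (hanti hF.1 hG hGF.symm)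
    refine ⟨v, hvF, fun H hH hvH ↦ ?_⟩
    by_contra hHF
    exact hvG (hjoint H hH hHF (Finset.mem_inter.2 ⟨hvF, hvH⟩))

/- A cover vertex of `F` outside the joint `G` lies in no member other than `F`, so it can be
exchanged for a vertex of `F ∩ G`. -/
theorem IsVertexCover.exists_card_le_of_joint {C : Finset V} (hC : IsVertexCover (S \ {G}) C)
    (hF : F ∈ S) (hGF : G ≠ F) (hFG : ¬ Disjoint F G) (hjoint : ∀ H ∈ S, H ≠ F → F ∩ H ⊆ G) :
    ∃ C', IsVertexCover S C' ∧ C'.card ≤ C.card := by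
  obtain ⟨w, hwF, hwG⟩ := Finset.not_disjoint_iff.1 hFG
  obtain ⟨v, hvF, hvC⟩ := hC F ⟨hF, hGF.symm⟩
  by_cases hvG : v ∈ G
  · refine ⟨C, fun H hH ↦ ?_, le_rfl⟩
    rcases eq_or_ne H G with rfl | hHG
    · exact ⟨v, hvG, hvC⟩
    · exact hC H ⟨hH, hHG⟩
  · refine ⟨insert w (C.erase v), fun H hH ↦ ?_, ?_⟩
    · by_cases hwH : w ∈ H
      · exact ⟨w, hwH, Finset.mem_insert_self _ _⟩
      · have hHF : H ≠ F := fun h ↦ hwH (h ▸ hwF)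
        obtain ⟨u, huH, huC⟩ := hC H ⟨hH, fun h ↦ hwH (h ▸ hwG)⟩
        refine ⟨u, huH, Finset.mem_insert_of_mem (Finset.mem_erase.2 ⟨?_, huC⟩)⟩
        rintro rfl
        exact hvG (hjoint H hH hHF (Finset.mem_inter.2 ⟨hvF, huH⟩))
    · exact (Finset.card_insert_le _ _).trans_eq (Finset.card_erase_add_one hvC)

theorem HasLeaves.exists_isMatching_isVertexCover_card_le [Finite V] (h : HasLeaves S)
    (hne : ∀ H ∈ S, H.Nonempty) :
    ∃ M C, IsMatching S M ∧ IsVertexCover S C ∧ C.card ≤ M.card := by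
  induction S using WellFoundedLT.induction with
  | ind S ih =>
  rcases S.eq_empty_or_nonempty with rfl | hS
  · exact ⟨∅, ∅, ⟨by simp, by simp⟩, by simp [IsVertexCover], le_rfl⟩
  have ih' (A : Finset V) (hA : A ∈ S) :=
    ih (S \ {A}) (Set.sdiff_singleton_ssubset.2 hA) (h.mono Set.sdiff_subset) fun H hH ↦ hne H hH.1
  obtain ⟨F, hF⟩ := h S subset_rfl hS
  rcases hF.disjoint_or_exists_joint with hdisj | ⟨G, hG, hGF, hFG, hjoint⟩
  · obtain ⟨M, C, hM, hC, hcard⟩ := ih' F hF.1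
    exact hM.exists_insert_of_disjoint hC hF.1 (hne F hF.1) hdisj hcard
  · obtain ⟨M, C, hM, hC, hcard⟩ := ih' G hG
    obtain ⟨C', hC', hcard'⟩ := hC.exists_card_le_of_joint hF.1 hGF hFG hjoint
    exact ⟨M, C', hM.mono Set.sdiff_subset, hC', hcard'.trans hcard⟩

/- Of the two members next to a leaf in the cycle, neither can be a joint of it. -/
theorem HasLeaves.not_specialCycle (h : HasLeaves S) {n : ℕ} {A : Fin (n + 3) → Finset V}
    (hA : ∀ i, A i ∈ S) {x : Fin (n + 3) → V} (hx : ∀ i j, x i ∈ A j ↔ j = i ∨ j = i + 1) :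
    False := by
  obtain ⟨_, ⟨j, rfl⟩, hleaf⟩ := h (Set.range A) (Set.range_subset_iff.2 hA) (Set.range_nonempty A)
  obtain ⟨i, rfl⟩ : ∃ i, j = i + 1 := ⟨j - 1, by simp⟩
  have h₁ : i + 1 ≠ i := by simp
  have h₂ : i + 1 + 1 ≠ i + 1 := by simp
  have h₃ : i + 1 + 1 ≠ i := by
    rw [add_assoc, Ne, add_eq_left, Fin.ext_iff, Fin.val_add]
    simp [Nat.mod_eq_of_lt (show 2 < n + 3 by lia)]
  have hpred : A i ≠ A (i + 1) := fun e ↦ by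
    have := (hx (i + 1) (i + 1)).2 (.inl rfl)
    rw [← e, hx] at this
    simp_all [eq_comm]
  have hsucc : A (i + 1 + 1) ≠ A (i + 1) := fun e ↦ by
    have := (hx i (i + 1)).2 (.inr rfl)
    rw [← e, hx] at this
    simp_all
  rcases hleaf with honly | ⟨_, ⟨g, rfl⟩, hg, hjoint⟩
  · exact hpred (honly.subset ⟨i, rfl⟩)
  have hxi : x i ∈ A g := (Finset.mem_inter.1 (hjoint _ ⟨i, rfl⟩ hpred
    (Finset.mem_inter.2 ⟨(hx _ _).2 (.inr rfl), (hx _ _).2 (.inl rfl)⟩))).2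
  have hxj : x (i + 1) ∈ A g := (Finset.mem_inter.1 (hjoint _ ⟨i + 1 + 1, rfl⟩ hsucc
    (Finset.mem_inter.2 ⟨(hx _ _).2 (.inl rfl), (hx _ _).2 (.inr rfl)⟩))).2
  rcases (hx _ _).1 hxi with rfl | rfl
  · rcases (hx _ _).1 hxj with h | h
    exacts [h₁ h.symm, h₃ h.symm]
  · exact hg rfl

theorem HasLeaves.not_triangle (h : HasLeaves S) {A B C : Finset V} (hA : A ∈ S) (hB : B ∈ S)
    (hC : C ∈ S) {x y z : V} (hx : x ∈ (A ∩ B) \ C) (hy : y ∈ (B ∩ C) \ A)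
    (hz : z ∈ (C ∩ A) \ B) : False := by
  simp only [Finset.mem_sdiff, Finset.mem_inter] at hx hy hz
  refine h.not_specialCycle (n := 0) (A := ![A, B, C]) (x := ![x, y, z]) ?_ ?_ <;>
    simp [Fin.forall_fin_succ, *]

theorem HasLeaves.not_quadrangle (h : HasLeaves S) {A B C D : Finset V} (hA : A ∈ S) (hB : B ∈ S)
    (hC : C ∈ S) (hD : D ∈ S) {w x y z : V} (hw : w ∈ (A ∩ B) \ (C ∪ D))
    (hx : x ∈ (B ∩ C) \ (D ∪ A)) (hy : y ∈ (C ∩ D) \ (A ∪ B)) (hz : z ∈ (D ∩ A) \ (B ∪ C)) :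
    False := by
  simp only [Finset.mem_sdiff, Finset.mem_inter, Finset.mem_union, not_or] at hw hx hy hz
  refine h.not_specialCycle (n := 1) (A := ![A, B, C, D]) (x := ![w, x, y, z]) ?_ ?_ <;>
    simp [Fin.forall_fin_succ, *]

/- Such an `E` would form a quadrangle with `A`, `F`, `B`, or a triangle with `F` and one of
`A`, `B`. -/
theorem HasLeaves.not_subset_union (h : HasLeaves S) (hanti : IsAntichain (· ⊆ ·) S)
    {A B E : Finset V} (hF : F ∈ S) (hA : A ∈ S) (hB : B ∈ S) (hE : E ∈ S) {a b : V}
    (ha : a ∈ (F ∩ A) \ B) (hb : b ∈ (F ∩ B) \ A) (haE : a ∉ E) (hbE : b ∉ E) : ¬ E ⊆ A ∪ B := by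
  intro hsub
  simp only [Finset.mem_sdiff, Finset.mem_inter] at ha hb
  obtain ⟨e, heE, heF⟩ := Finset.not_subset.1 (hanti hE hF fun h ↦ haE (h ▸ ha.1.1))
  by_cases hEA : E \ F ⊆ A
  · obtain ⟨c, hcE, hcA⟩ := Finset.not_subset.1 (hanti hE hA fun h ↦ haE (h ▸ ha.1.2))
    exact h.not_triangle hF hE hA (x := c) (y := e) (z := a) (by grind) (by grind) (by grind)
  by_cases hEB : E \ F ⊆ B
  · obtain ⟨d, hdE, hdB⟩ := Finset.not_subset.1 (hanti hE hB fun h ↦ hbE (h ▸ hb.1.2))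
    exact h.not_triangle hF hE hB (x := d) (y := e) (z := b) (by grind) (by grind) (by grind)
  obtain ⟨c, hcE, hcA⟩ := Finset.not_subset.1 hEA
  obtain ⟨d, hdE, hdB⟩ := Finset.not_subset.1 hEB
  exact h.not_quadrangle hF hA hE hB (w := a) (x := d) (y := c) (z := b) (by grind) (by grind)
    (by grind) (by grind)

end Leaves

section Graftings

variable {V : Type*} [DecidableEq V] {S : Set (Finset V)} {L M : Finset (Finset V)} {F : Finset V}

/-- The family `S` is grafted with leaves `L`, in the sense of Faridi's grafted simplicial
complexes: `L` is a matching covering all vertices of `S`, and each member of `L` meets the members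
of `S` in a chain of sets, which makes it a leaf. -/
structure IsGrafting (S : Set (Finset V)) (L : Finset (Finset V)) : Prop extends
    IsMatching S L where
  exists_mem : ∀ H ∈ S, ∀ v ∈ H, ∃ F ∈ L, v ∈ F
  chain : ∀ F ∈ L, ∀ A ∈ S, ∀ B ∈ S, F ∩ A ⊆ B ∨ F ∩ B ⊆ A

/- Otherwise there are `a ∈ F ∩ A ∖ B` and `b ∈ F ∩ B ∖ A`, and a minimal vertex cover meeting
`A ∪ B` only in `a` and `b` contains both of them. -/
theorem HasLeaves.inter_subset_or_inter_subset [Finite V] (h : HasLeaves S)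
    (hanti : IsAntichain (· ⊆ ·) S) (hM : IsMatching S M)
    (hcard : ∀ C, Minimal (IsVertexCover S) C → C.card ≤ M.card) (hF : F ∈ M) {A B : Finset V}
    (hA : A ∈ S) (hB : B ∈ S) : F ∩ A ⊆ B ∨ F ∩ B ⊆ A := by
  by_contra! hcon
  obtain ⟨a, ha, haB⟩ := Finset.not_subset.1 hcon.1
  obtain ⟨b, hb, hbA⟩ := Finset.not_subset.1 hcon.2
  obtain ⟨C, hC, hCAB⟩ := exists_minimal_isVertexCover_disjoint (S := S) (T := (A ∪ B) \ {a, b})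
    fun E hE hEAB ↦ h.not_subset_union hanti (hM.subset hF) hA hB hE (a := a) (b := b)
      (by simp_all) (by simp_all) (fun haE ↦ by simpa using hEAB haE)
      (fun hbE ↦ by simpa using hEAB hbE) (hEAB.trans Finset.sdiff_subset)
  have hC_eq {w : V} (hwC : w ∈ C) (hw : w ∈ A ∪ B) : w = a ∨ w = b := by
    by_contra! hwab
    exact Finset.disjoint_left.1 hCAB hwC (by simp_all)
  have haC : a ∈ C := by
    obtain ⟨w, hwA, hwC⟩ := hC.1 A hA
    grind
  have hbC : b ∈ C := by
    obtain ⟨w, hwB, hwC⟩ := hC.1 B hB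
    grind
  obtain rfl := hM.eq_of_mem_cover_of_card_le hC.1 (hcard C hC) hF (Finset.mem_inter.1 ha).1 haC
    (Finset.mem_inter.1 hb).1 hbC
  exact hbA (Finset.mem_inter.1 ha).2

theorem HasLeaves.exists_isGrafting [Finite V] (h : HasLeaves S) (hne : ∀ H ∈ S, H.Nonempty)
    (hanti : IsAntichain (· ⊆ ·) S) (hunmixed : IsUnmixed S) : ∃ L, IsGrafting S L := by
  obtain ⟨M, C₀, hM, hC₀, hcard₀⟩ := h.exists_isMatching_isVertexCover_card_le hne
  have hcard (C) (hC : Minimal (IsVertexCover S) C) : C.card ≤ M.card :=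
    (hunmixed hC hC₀).trans hcard₀
  exact ⟨M, hM, fun H hH v ↦ hM.exists_mem_of_forall_minimal_card_le hcard hanti hH,
    fun F hF A hA B ↦ h.inter_subset_or_inter_subset hanti hM hcard hF hA⟩

theorem IsGrafting.mem_of_isLeafOf (h : IsGrafting S L)
    (hF : IsLeafOf S F) (hne : F.Nonempty) (hanti : IsAntichain (· ⊆ ·) S) : F ∈ L := by
  obtain ⟨v, hvF, hfree⟩ := hF.exists_free_vertex hne hanti
  obtain ⟨A, hA, hvA⟩ := h.exists_mem F hF.1 v hvF
  rwa [← hfree A (h.subset hA) hvA]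

theorem IsGrafting.erase (h : IsGrafting S L) (hF : F ∈ L) :
    IsGrafting {H ∈ S | Disjoint H F} (L.erase F) where
  subset A hA := by
    rw [Finset.coe_erase] at hA
    exact ⟨h.subset hA.1, h.pairwiseDisjoint hA.1 hF hA.2⟩
  pairwiseDisjoint := h.pairwiseDisjoint.subset (Finset.coe_subset.2 (Finset.erase_subset F L))
  exists_mem H hH v hv := by
    obtain ⟨A, hA, hvA⟩ := h.exists_mem H hH.1 v hv
    refine ⟨A, Finset.mem_erase.2 ⟨?_, hA⟩, hvA⟩
    rintro rfl
    exact Finset.disjoint_left.1 hH.2 hv hvA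
  chain A hA B hB E hE := h.chain A (Finset.mem_of_mem_erase hA) B hB.1 E hE.1

end Graftings

section Forests

variable {V : Type*} {D : PreAbstractSimplicialComplex V}

theorem nonempty_of_mem_facets {F : Finset V} (hF : F ∈ facets D) : F.Nonempty :=
  (D.isRelLowerSet_faces hF.1).1

theorem isAntichain_facets (D : PreAbstractSimplicialComplex V) :
    IsAntichain (· ⊆ ·) (facets D) :=
  setOfPred_maximal_antichain _

theorem exists_mem_facets_superset [Finite V] {s : Finset V} (hs : s ∈ D.faces) :
    ∃ F ∈ facets D, s ⊆ F := by
  have := Fintype.ofFinite V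
  obtain ⟨F, hsF, hF⟩ := exists_maximal_ge_of_wellFoundedGT (· ∈ D.faces) s hs
  exact ⟨F, hF, hsF⟩

theorem facets_generated {S : Set (Finset V)} (hne : ∀ F ∈ S, F.Nonempty)
    (hanti : IsAntichain (· ⊆ ·) S) : facets (generated S) = S := by
  ext F
  constructor
  · rintro ⟨⟨hF, G, hG, hFG⟩, hmax⟩
    rwa [hFG.antisymm (hmax ⟨hF.mono hFG, G, hG, subset_rfl⟩ hFG)]
  · refine fun hF ↦ ⟨⟨hne F hF, F, hF, subset_rfl⟩, ?_⟩
    rintro A ⟨_, G, hG, hAG⟩ hFA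
    rwa [hanti.eq hF hG (hFA.trans hAG)]

theorem facets_generated_of_subset {S : Set (Finset V)} (hS : S ⊆ facets D) :
    facets (generated S) = S :=
  facets_generated (fun _ hF ↦ nonempty_of_mem_facets (hS hF)) ((isAntichain_facets D).subset hS)

variable [DecidableEq V] {F A B : Finset V}

/-- A step in the chains of facets of `IsConnected`. -/
def IsFacetStep (D : PreAbstractSimplicialComplex V) (A B : Finset V) : Prop :=
  B ∈ facets D ∧ (A ∩ B).Nonempty

/-- The connected component of the facet `F` in `D`: its facets are those joined to `F` by a chain
of facets. -/
def connectedComponent (D : PreAbstractSimplicialComplex V) (F : Finset V) :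
    PreAbstractSimplicialComplex V :=
  generated {B | B ∈ facets D ∧ Relation.ReflTransGen (IsFacetStep D) F B}

theorem mem_facets_connectedComponent : B ∈ facets (connectedComponent D F) ↔
    B ∈ facets D ∧ Relation.ReflTransGen (IsFacetStep D) F B := by
  rw [connectedComponent, facets_generated_of_subset fun _ h ↦ h.1]
  rfl

theorem mem_facets_connectedComponent_self (hF : F ∈ facets D) :
    F ∈ facets (connectedComponent D F) :=
  mem_facets_connectedComponent.2 ⟨hF, .refl⟩

theorem mem_facets_connectedComponent_of_inter_nonempty
    (hA : A ∈ facets (connectedComponent D F)) (hB : B ∈ facets D) (hAB : (A ∩ B).Nonempty) :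
    B ∈ facets (connectedComponent D F) := by
  rw [mem_facets_connectedComponent] at hA ⊢
  exact ⟨hB, hA.2.tail ⟨hB, hAB⟩⟩

theorem isConnected_connectedComponent (hF : F ∈ facets D) :
    IsConnected (connectedComponent D F) := by
  set G := connectedComponent D F
  have hpath (B : Finset V) (hB : Relation.ReflTransGen (IsFacetStep D) F B) :
      B ∈ facets G ∧ Relation.ReflTransGen (IsFacetStep G) F B ∧
        Relation.ReflTransGen (IsFacetStep G) B F := by
    induction hB with
    | refl => exact ⟨mem_facets_connectedComponent_self hF, .refl, .refl⟩
    | @tail A B _ hAB ih =>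
      have hB := mem_facets_connectedComponent_of_inter_nonempty ih.1 hAB.1 hAB.2
      have hBA : IsFacetStep G B A := ⟨ih.1, by rw [Finset.inter_comm]; exact hAB.2⟩
      exact ⟨hB, ih.2.1.tail ⟨hB, hAB.2⟩, ih.2.2.head hBA⟩
  exact fun A hA B hB ↦ (hpath A (mem_facets_connectedComponent.1 hA).2).2.2.trans
    (hpath B (mem_facets_connectedComponent.1 hB).2).2.1

theorem isComponent_connectedComponent [Finite V] (hF : F ∈ facets D) :
    IsComponent (connectedComponent D F) D := by
  have hsub : IsSubcomplex (connectedComponent D F) D :=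
    fun B hB ↦ (mem_facets_connectedComponent.1 hB).1
  refine ⟨⟨hsub, ⟨F, mem_facets_connectedComponent_self hF⟩,
    isConnected_connectedComponent hF⟩, ?_⟩
  rintro E ⟨hED, -, hE⟩ hle s hs
  have hFE : F ∈ facets E := by
    obtain ⟨B, hB, hFB⟩ :=
      exists_mem_facets_superset (hle (mem_facets_connectedComponent_self hF).1)
    rwa [(isAntichain_facets D).eq hF (hED hB) hFB]
  obtain ⟨B, hB, hsB⟩ := exists_mem_facets_superset hs
  exact ⟨(E.isRelLowerSet_faces hs).1, B, ⟨hED hB,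
    Relation.ReflTransGen.mono (fun _ _ h ↦ ⟨hED h.1, h.2⟩) _ _ (hE F hFE B hB)⟩, hsB⟩

theorem HasLeaves.isForest (h : HasLeaves (facets D)) : IsForest D :=
  fun _ hG ↦ ⟨hG.1.2.2, fun E hE ↦ h (facets E) (hE.trans hG.1.1)⟩

theorem IsForest.hasLeaves [Finite V] (h : IsForest D) : HasLeaves (facets D) := by
  rintro T hT ⟨F₀, hF₀⟩
  set G := connectedComponent D F₀
  have hTG : facets (generated (T ∩ facets G)) = T ∩ facets G :=
    facets_generated_of_subset (D := D) fun A hA ↦ hT hA.1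
  obtain ⟨F, hF⟩ := (h G (isComponent_connectedComponent (hT hF₀))).2 (generated (T ∩ facets G))
    (hTG.trans_subset Set.inter_subset_right)
    (by rw [hTG]; exact ⟨F₀, hF₀, mem_facets_connectedComponent_self (hT hF₀)⟩)
  have hF' : IsLeafOf (T ∩ facets G) F := hTG ▸ hF
  refine ⟨F, hF'.of_disjoint Set.inter_subset_left fun H hH hHG ↦ ?_⟩
  rw [Finset.disjoint_iff_inter_eq_empty, ← Finset.not_nonempty_iff_eq_empty]
  exact fun hFH ↦ hHG ⟨hH, mem_facets_connectedComponent_of_inter_nonempty hF'.1.2 (hT hH) hFH⟩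

theorem facets_deleteClosedNeighborhood_eq_disjoint (hF : F.Nonempty) :
    facets (deleteClosedNeighborhood D F) = {H ∈ facets D | Disjoint H F} := by
  rw [facets_deleteClosedNeighborhood]
  ext H
  refine and_congr_right fun hH ↦ ?_
  simp only [closedNeighborhood, Set.mem_ofPred_eq, hH, true_and, not_or,
    Finset.not_nonempty_iff_eq_empty, Finset.disjoint_iff_inter_eq_empty]
  refine and_iff_right_of_imp ?_
  rintro h rfl
  exact hF.ne_empty (by rwa [Finset.inter_self] at h)

end Forests

section FacetIdeals

open MvPolynomial

variable {V K : Type*} [Field K] {D : PreAbstractSimplicialComplex V} {S T C : Finset V}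

/-- The exponent vector of the square-free monomial `x_S`. -/
noncomputable def squarefreeExponent (S : Finset V) : V →₀ ℕ :=
  ∑ v ∈ S, Finsupp.single v 1

theorem squarefreeExponent_apply [DecidableEq V] (S : Finset V) (v : V) :
    squarefreeExponent S v = if v ∈ S then 1 else 0 := by
  simp [squarefreeExponent, Finsupp.finsetSum_apply, Finsupp.single_apply]

theorem squarefreeExponent_le_iff {u : V →₀ ℕ} : squarefreeExponent S ≤ u ↔ S ⊆ u.support := by
  classical
  simp only [Finsupp.le_def, squarefreeExponent_apply, Finset.subset_iff, Finsupp.mem_support_iff,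
    ← Nat.one_le_iff_ne_zero]
  exact forall_congr' fun v ↦ by split_ifs <;> simp [*]

theorem monomialOf_eq_monomial (S : Finset V) :
    monomialOf K S = monomial (squarefreeExponent S) 1 :=
  (monomial_sum_one _ _).symm

theorem monomialOf_mem_span_X_image :
    monomialOf K S ∈ (Ideal.span (X '' C) : Ideal (MvPolynomial V K)) ↔ ∃ v ∈ S, v ∈ C := by
  classical
  simp [monomialOf_eq_monomial, mem_ideal_span_X_image, squarefreeExponent_apply, and_comm,
    support_monomial]

theorem monomialOf_dvd_monomialOf (h : S ⊆ T) : monomialOf K S ∣ monomialOf K T :=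
  Finset.prod_dvd_prod_of_subset _ _ _ h

theorem facetIdeal_le_span_X_image :
    facetIdeal K D ≤ Ideal.span (X '' C) ↔ IsVertexCover (facets D) C := by
  simp only [facetIdeal, Ideal.span_le, Set.image_subset_iff]
  exact forall₂_congr fun H _ ↦ monomialOf_mem_span_X_image

theorem exists_isVertexCover_span_X_image_le [Finite V] {Q : Ideal (MvPolynomial V K)} [Q.IsPrime]
    (hQ : facetIdeal K D ≤ Q) :
    ∃ C : Finset V, IsVertexCover (facets D) C ∧ Ideal.span (X '' C) ≤ Q := by
  refine ⟨(Set.toFinite {v | X v ∈ Q}).toFinset, fun H hH ↦ ?_, ?_⟩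
  · simpa using Ideal.IsPrime.prod_mem_iff.1 (hQ (Ideal.subset_span ⟨H, hH, rfl⟩))
  · rw [Ideal.span_le, Set.image_subset_iff, Set.Finite.coe_toFinset]
    exact subset_rfl

/- It is the annihilator of the product of the variables outside the cover. -/
theorem span_X_image_mem_associatedPrimes [Finite V] (hC : Minimal (IsVertexCover (facets D)) C) :
    Ideal.span (X '' C) ∈
      associatedPrimes (MvPolynomial V K) (MvPolynomial V K ⧸ facetIdeal K D) := by
  classical
  have := Fintype.ofFinite V
  have hprime := isPrime_span_X_image (R := K) (C : Set V)
  refine isAssociatedPrime_iff.2 ⟨hprime, Ideal.Quotient.mk _ (monomialOf K Cᶜ), ?_⟩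
  refine le_antisymm (Ideal.span_le.2 ?_) fun f hf ↦ ?_
  · rintro _ ⟨c, hc, rfl⟩
    obtain ⟨H, hH, hHC⟩ := exists_mem_forall_eq_of_minimal hC hc
    rw [SetLike.mem_coe, Submodule.mem_colon_singleton, Submodule.mem_bot,
      ← Ideal.Quotient.mk_eq_mk, ← Submodule.Quotient.mk_smul, Submodule.Quotient.mk_eq_zero]
    have hsub : H ⊆ insert c Cᶜ := fun v hv ↦ by
      by_cases hvC : v ∈ C
      · exact Finset.mem_insert.2 (.inl (hHC v hv hvC))
      · exact Finset.mem_insert_of_mem (Finset.mem_compl.2 hvC)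
    have hdvd := monomialOf_dvd_monomialOf (K := K) hsub
    rw [monomialOf, monomialOf, Finset.prod_insert (by simpa using hc)] at hdvd
    exact Ideal.mem_of_dvd _ hdvd (Ideal.subset_span ⟨H, hH, rfl⟩)
  · rw [Submodule.mem_colon_singleton, Submodule.mem_bot, ← Ideal.Quotient.mk_eq_mk,
      ← Submodule.Quotient.mk_smul, Submodule.Quotient.mk_eq_zero] at hf
    refine (hprime.mem_or_mem (facetIdeal_le_span_X_image.2 hC.1 hf)).resolve_right fun h ↦ ?_
    obtain ⟨v, hv, hvC⟩ := monomialOf_mem_span_X_image.1 h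
    exact Finset.mem_compl.1 hv hvC

theorem isPrime_idealOfVars : (idealOfVars V K).IsPrime := by
  rw [idealOfVars, ← Set.image_univ]
  exact isPrime_span_X_image _

theorem depthQuotient_le_ringKrullDim_quotient [Finite V] {I P : Ideal (MvPolynomial V K)}
    (hP : P ∈ associatedPrimes (MvPolynomial V K) (MvPolynomial V K ⧸ I))
    (hPV : P ≤ idealOfVars V K) : depthQuotient I ≤ ringKrullDim (MvPolynomial V K ⧸ P) := by
  have := isPrime_idealOfVars (V := V) (K := K)
  exact iSup₂_le fun rs hrs ↦ length_le_ringKrullDim_quotient_of_mem_associatedPrimes rs hrs.1 _ P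
    hP hPV hrs.2.toIsWeaklyRegular

theorem ringKrullDim_quotient_span_X_image_finset [Finite V] (C : Finset V) :
    ringKrullDim (MvPolynomial V K ⧸ (Ideal.span (X '' C) : Ideal (MvPolynomial V K))) =
      (Nat.card V - C.card : ℕ) := by
  rw [ringKrullDim_quotient_span_X_image, ringKrullDim_eq_zero_of_field, zero_add, Set.ncard_compl,
    Set.ncard_coe_finset]

theorem depthQuotient_facetIdeal_le [Finite V] (hC : Minimal (IsVertexCover (facets D)) C) :
    depthQuotient (facetIdeal K D) ≤ (Nat.card V - C.card : ℕ) := by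
  rw [← ringKrullDim_quotient_span_X_image_finset (K := K)]
  exact depthQuotient_le_ringKrullDim_quotient (span_X_image_mem_associatedPrimes hC)
    (Ideal.span_mono (Set.image_subset_range _ _))

theorem IsVertexCover.le_ringKrullDim_quotient_facetIdeal [Finite V]
    (hC : IsVertexCover (facets D) C) :
    (Nat.card V - C.card : ℕ) ≤ ringKrullDim (MvPolynomial V K ⧸ facetIdeal K D) := by
  rw [← ringKrullDim_quotient_span_X_image_finset (K := K)]
  exact ringKrullDim_le_of_surjective _
    (Ideal.Quotient.factor_surjective (facetIdeal_le_span_X_image.2 hC))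

theorem ringKrullDim_quotient_facetIdeal_le [Finite V] {m : ℕ}
    (h : ∀ C, IsVertexCover (facets D) C → m ≤ C.card) :
    ringKrullDim (MvPolynomial V K ⧸ facetIdeal K D) ≤ (Nat.card V - m : ℕ) := by
  refine ringKrullDim_quotient_le_of_forall_prime fun Q _ hQ ↦ ?_
  obtain ⟨C, hC, hCQ⟩ := exists_isVertexCover_span_X_image_le hQ
  calc ringKrullDim (MvPolynomial V K ⧸ Q)
      ≤ ringKrullDim (MvPolynomial V K ⧸ (Ideal.span (X '' C) : Ideal (MvPolynomial V K))) :=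
        ringKrullDim_le_of_surjective _ (Ideal.Quotient.factor_surjective hCQ)
    _ = (Nat.card V - C.card : ℕ) := ringKrullDim_quotient_span_X_image_finset C
    _ ≤ (Nat.card V - m : ℕ) := by
        have := h C hC
        gcongr

theorem IsCohenMacaulayQuotient.isUnmixed [Finite V]
    (h : IsCohenMacaulayQuotient (facetIdeal K D)) : IsUnmixed (facets D) := by
  intro C C' hC hC'
  have hle : ((Nat.card V - C'.card : ℕ) : WithBot ℕ∞) ≤ (Nat.card V - C.card : ℕ) :=
    hC'.le_ringKrullDim_quotient_facetIdeal.trans (h.ge.trans (depthQuotient_facetIdeal_le hC))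
  have hcard : C.card ≤ Nat.card V := by
    have := Fintype.ofFinite V
    rw [Nat.card_eq_fintype_card]
    exact C.card_le_univ
  have := Nat.cast_le.1 hle
  lia

theorem IsCohenMacaulayForest.exists_isGrafting [Finite V] [DecidableEq V]
    (h : IsCohenMacaulayForest K D) : ∃ L, IsGrafting (facets D) L :=
  h.1.hasLeaves.exists_isGrafting (fun _ ↦ nonempty_of_mem_facets) (isAntichain_facets D)
    h.2.isUnmixed

end FacetIdeals

section Degrees

variable {V : Type*} {S : Set (Finset V)} {L : Finset (Finset V)} {ρ : V → V} {d : V → ℕ}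

/-- The vertices of the family `S`. -/
def vertices (S : Set (Finset V)) : Set V :=
  {v | ∃ H ∈ S, v ∈ H}

/-- The number of members of `S` containing the vertex `v`. -/
noncomputable def degree (S : Set (Finset V)) (v : V) : ℕ :=
  {H ∈ S | v ∈ H}.ncard

/-- The retraction `ρ` partitions the vertices into its fibres; within a fibre the vertices are
ordered by `d`, with `ρ v` last, and a vertex lies in every member of `S` that contains an earlier
one. This says that the square-free monomials of the members of `S` are the polarizations of the
monomials obtained from them by replacing each variable `x_v` by `x_{ρ v}`. -/
structure IsRootMap (S : Set (Finset V)) (ρ : V → V) (d : V → ℕ) : Prop where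
  idem : ∀ v, ρ (ρ v) = ρ v
  le : ∀ v, d v ≤ d (ρ v)
  mem_of_mem : ∀ ⦃v w⦄, ρ v = ρ w → d w ≤ d v → ∀ H ∈ S, w ∈ H → v ∈ H

theorem IsRootMap.map_mem (h : IsRootMap S ρ d) {v : V} {H : Finset V} (hH : H ∈ S) (hv : v ∈ H) :
    ρ v ∈ H :=
  h.mem_of_mem (h.idem v) (h.le v) H hH hv

theorem IsGrafting.mem_of_degree_le [Finite V] [DecidableEq V] (h : IsGrafting S L) {F : Finset V}
    (hF : F ∈ L) {v w : V} (hv : v ∈ F) (hw : w ∈ F) (hle : degree S w ≤ degree S v) {H : Finset V}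
    (hH : H ∈ S) (hwH : w ∈ H) : v ∈ H := by
  by_contra hvH
  have hsub : {A ∈ S | v ∈ A} ⊆ {A ∈ S | w ∈ A} := fun A hA ↦ by
    refine ⟨hA.1, (h.chain F hF A hA.1 H hH).elim (fun hc ↦ ?_) fun hc ↦ ?_⟩
    · exact absurd (hc (Finset.mem_inter.2 ⟨hv, hA.2⟩)) hvH
    · exact hc (Finset.mem_inter.2 ⟨hw, hwH⟩)
  have heq := Set.eq_of_subset_of_ncard_le hsub hle
  exact hvH (heq.ge ⟨hH, hwH⟩).2

theorem IsMatching.exists_forall_mem_eq (h : IsMatching S L) (r : Finset V → V) :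
    ∃ ρ : V → V, (∀ F ∈ L, ∀ v ∈ F, ρ v = r F) ∧ ∀ v, (∀ F ∈ L, v ∉ F) → ρ v = v := by
  classical
  choose! G hG hvG using fun (v : V) (hv : ∃ F ∈ L, v ∈ F) ↦ hv
  refine ⟨fun v ↦ if ∃ F ∈ L, v ∈ F then r (G v) else v, fun F hF v hv ↦ ?_, fun v hv ↦ ?_⟩
  · have hex : ∃ F ∈ L, v ∈ F := ⟨F, hF, hv⟩
    simp only [if_pos hex, h.eq_of_mem (hG v hex) hF (hvG v hex) hv]
  · exact if_neg (by simpa using hv)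

theorem IsGrafting.exists_isRootMap [Finite V] [DecidableEq V] (h : IsGrafting S L)
    (hne : ∀ F ∈ L, F.Nonempty) :
    ∃ ρ, IsRootMap S ρ (degree S) ∧ {v ∈ vertices S | ρ v = v}.ncard ≤ L.card := by
  obtain _ | _ := isEmpty_or_nonempty V
  · exact ⟨id, ⟨isEmptyElim, isEmptyElim, isEmptyElim⟩, by simp [Set.eq_empty_of_isEmpty]⟩
  choose! r hr hrmax using fun (F : Finset V) (hF : F ∈ L) ↦
    F.exists_max_image (degree S) (hne F hF)
  obtain ⟨ρ, hρ, hρ'⟩ := h.exists_forall_mem_eq r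
  have hcases (v : V) : (∃ F ∈ L, v ∈ F ∧ ρ v = r F) ∨ ρ v = v := by
    by_cases hv : ∃ F ∈ L, v ∈ F
    · obtain ⟨F, hF, hvF⟩ := hv
      exact .inl ⟨F, hF, hvF, hρ F hF v hvF⟩
    · exact .inr (hρ' v (by simpa using hv))
  refine ⟨ρ, ⟨fun v ↦ ?_, fun v ↦ ?_, fun v w hvw hle H hH hwH ↦ ?_⟩, ?_⟩
  · rcases hcases v with ⟨F, hF, -, hv⟩ | hv
    · rw [hv, hρ F hF _ (hr F hF)]
    · rw [hv, hv]
  · rcases hcases v with ⟨F, hF, hvF, hv⟩ | hv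
    · exact (hrmax F hF v hvF).trans_eq (congrArg _ hv.symm)
    · rw [hv]
  · obtain ⟨F, hF, hwF⟩ := h.exists_mem H hH w hwH
    have hvF : v ∈ F := by
      rw [hρ F hF w hwF] at hvw
      rcases hcases v with ⟨G, hG, hvG, hv⟩ | hv
      · rwa [← h.eq_of_mem hG hF (hr G hG) (hv.symm.trans hvw ▸ hr F hF)]
      · exact hv.symm.trans hvw ▸ hr F hF
    exact h.mem_of_degree_le hF hvF hwF hle hH hwH
  · rw [← Set.ncard_coe_finset]
    refine (Set.ncard_le_ncard (t := r '' L) ?_).trans (Set.ncard_image_le (Set.toFinite _))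
    rintro v ⟨⟨H, hH, hvH⟩, hv⟩
    obtain ⟨F, hF, hvF⟩ := h.exists_mem H hH v hvH
    exact ⟨F, hF, (hρ F hF v hvF).symm.trans hv⟩

end Degrees

section Depolarization

open MvPolynomial

variable {V K : Type*} [Field K] {D : PreAbstractSimplicialComplex V} {ρ : V → V} {d : V → ℕ}
  {S : Set (Finset V)} {B : Finset V}

open Classical in
/-- The image of the variable `x_v` under depolarization: the variable of its root, or zero if `v`
is not a vertex. -/
noncomputable def rootVariable (K : Type*) [Field K] (S : Set (Finset V)) (ρ : V → V) (v : V) :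
    MvPolynomial V K :=
  if v ∈ vertices S then X (ρ v) else 0

open Classical in
/-- The partial depolarization: it replaces only the variables in `B` by their root variables. -/
noncomputable def depolarization (K : Type*) [Field K] (S : Set (Finset V)) (ρ : V → V)
    (B : Finset V) : MvPolynomial V K →ₐ[K] MvPolynomial V K :=
  aeval (B.piecewise (rootVariable K S ρ) X)

theorem depolarization_X_of_mem {v : V} (hv : v ∈ B) :
    depolarization K S ρ B (X v) = rootVariable K S ρ v := by
  classical
  rw [depolarization, aeval_X, Finset.piecewise_eq_of_mem _ _ _ hv]

theorem depolarization_X_of_notMem {v : V} (hv : v ∉ B) :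
    depolarization K S ρ B (X v) = X v := by
  classical
  rw [depolarization, aeval_X, Finset.piecewise_eq_of_notMem _ _ _ hv]

theorem IsRootMap.depolarization_rootVariable (h : IsRootMap S ρ d)
    (hB : ∀ v ∈ B, v ∈ vertices S → ρ v ≠ v) (v : V) :
    depolarization K S ρ B (rootVariable K S ρ v) = rootVariable K S ρ v := by
  unfold rootVariable
  split_ifs with hv
  · obtain ⟨H, hH, hvH⟩ := hv
    exact depolarization_X_of_notMem fun hρB ↦ hB _ hρB ⟨H, hH, h.map_mem hH hvH⟩ (h.idem v)
  · exact map_zero _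

theorem IsRootMap.depolarization_depolarization (h : IsRootMap S ρ d)
    (hB : ∀ v ∈ B, v ∈ vertices S → ρ v ≠ v) (f : MvPolynomial V K) :
    depolarization K S ρ B (depolarization K S ρ B f) = depolarization K S ρ B f := by
  suffices (depolarization K S ρ B).comp (depolarization K S ρ B) = depolarization K S ρ B from
    DFunLike.congr_fun this f
  ext v
  by_cases hv : v ∈ B
  · simp [depolarization_X_of_mem hv, h.depolarization_rootVariable hB]
  · simp [depolarization_X_of_notMem hv]

theorem IsRootMap.ker_depolarization (h : IsRootMap S ρ d)
    (hB : ∀ v ∈ B, v ∈ vertices S → ρ v ≠ v) :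
    RingHom.ker (depolarization K S ρ B) =
      Ideal.span ((fun v ↦ X v - rootVariable K S ρ v) '' B) := by
  rw [ker_eq_span_X_sub (B := (B : Set V)) (fun v hv ↦ depolarization_X_of_notMem hv)
    (h.depolarization_depolarization hB)]
  exact congrArg _ (Set.image_congr fun v hv ↦ by rw [depolarization_X_of_mem hv])

open Classical in
/-- The exponent vector of the partial depolarization of the monomial `x_H`. -/
noncomputable def depolarizedExponent (ρ : V → V) (B H : Finset V) : V →₀ ℕ :=
  ∑ v ∈ H, Finsupp.single (B.piecewise ρ id v) 1

theorem depolarizedExponent_apply [DecidableEq V] (B H : Finset V) (w : V) :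
    depolarizedExponent ρ B H w = {v ∈ H | B.piecewise ρ id v = w}.card := by
  simp only [depolarizedExponent, Finsupp.finsetSum_apply, Finsupp.single_apply,
    Finset.card_filter]
  congr!

theorem map_depolarization_facetIdeal :
    (facetIdeal K D).map (depolarization K (facets D) ρ B) =
      Ideal.span ((fun s ↦ monomial s 1) '' (depolarizedExponent ρ B '' facets D)) := by
  classical
  rw [facetIdeal, Ideal.map_span, Set.image_image, Set.image_image]
  refine congrArg _ (Set.image_congr fun H hH ↦ ?_)
  rw [monomialOf, map_prod, depolarizedExponent, monomial_sum_one]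
  refine Finset.prod_congr rfl fun v hv ↦ ?_
  by_cases hvB : v ∈ B
  · rw [depolarization_X_of_mem hvB, rootVariable, if_pos ⟨H, hH, hv⟩,
      Finset.piecewise_eq_of_mem _ _ _ hvB, X]
  · rw [depolarization_X_of_notMem hvB, Finset.piecewise_eq_of_notMem _ _ _ hvB, id, X]

theorem IsRootMap.depolarizedExponent_apply_of_notMem [DecidableEq V]
    (h : IsRootMap S ρ d) {H : Finset V} (hH : H ∈ S) {b : V} (hbB : b ∉ B)
    (hb : b ∈ vertices S → ρ b ≠ b) :
    depolarizedExponent ρ B H b = if b ∈ H then 1 else 0 := by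
  have hfilter : {v ∈ H | B.piecewise ρ id v = b} = {v ∈ H | v = b} := by
    refine Finset.filter_congr fun v hv ↦ ?_
    by_cases hvB : v ∈ B
    · rw [Finset.piecewise_eq_of_mem _ _ _ hvB, iff_false_right (ne_of_mem_of_not_mem hvB hbB)]
      rintro rfl
      exact hb ⟨H, hH, h.map_mem hH hv⟩ (h.idem v)
    · rw [Finset.piecewise_eq_of_notMem _ _ _ hvB, id]
  rw [depolarizedExponent_apply, hfilter, Finset.filter_eq']
  split_ifs <;> rfl

theorem IsRootMap.depolarizedExponent_apply_root_le
    (h : IsRootMap S ρ d) {H H' : Finset V} (hH : H ∈ S) {b : V} (hbH : b ∈ H)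
    (hB : ∀ v ∈ B, d b ≤ d v) :
    depolarizedExponent ρ B H' (ρ b) ≤ depolarizedExponent ρ B H (ρ b) := by
  classical
  rw [depolarizedExponent_apply, depolarizedExponent_apply]
  refine Finset.card_le_card fun v hv ↦ ?_
  rw [Finset.mem_filter] at hv ⊢
  refine ⟨?_, hv.2⟩
  by_cases hvB : v ∈ B
  · rw [Finset.piecewise_eq_of_mem _ _ _ hvB] at hv
    exact h.mem_of_mem hv.2 (hB v hvB) H hH hbH
  · rw [Finset.piecewise_eq_of_notMem _ _ _ hvB, id] at hv
    exact hv.2 ▸ h.map_mem hH hbH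

theorem IsRootMap.isSMulRegular_X_sub_rootVariable (h : IsRootMap (facets D) ρ d)
    (hB : ∀ v ∈ B, v ∈ vertices (facets D) → ρ v ≠ v) {b : V} (hbB : b ∉ B)
    (hb : b ∈ vertices (facets D) → ρ b ≠ b) (hBb : ∀ v ∈ B, d b ≤ d v) :
    IsSMulRegular
      (MvPolynomial V K ⧸ RingHom.ker (depolarization K (facets D) ρ B) ⊔ facetIdeal K D)
      (X b - rootVariable K (facets D) ρ b) := by
  classical
  rw [← comap_map_eq_ker_sup _ (h.depolarization_depolarization hB)]
  refine isSMulRegular_quotient_comap _ ?_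
  rw [map_sub, depolarization_X_of_notMem hbB, h.depolarization_rootVariable hB,
    map_depolarization_facetIdeal, rootVariable]
  split_ifs with hbv
  · refine isSMulRegular_X_sub_X_quotient (hb hbv) ?_ ?_
    · rintro _ ⟨H, hH, rfl⟩
      rw [h.depolarizedExponent_apply_of_notMem hH hbB hb]
      split_ifs <;> simp
    · rintro _ ⟨H, hH, rfl⟩ hbH _ ⟨H', -, rfl⟩
      rw [h.depolarizedExponent_apply_of_notMem hH hbB hb, ite_ne_right_iff] at hbH
      exact h.depolarizedExponent_apply_root_le hH hbH.1 hBb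
  · rw [sub_zero]
    refine isSMulRegular_X_quotient ?_
    rintro _ ⟨H, hH, rfl⟩
    rw [h.depolarizedExponent_apply_of_notMem hH hbB hb, if_neg fun hbH ↦ hbv ⟨H, hH, hbH⟩]

theorem IsRootMap.exists_isWeaklyRegular (h : IsRootMap (facets D) ρ d)
    (hB : ∀ v ∈ B, v ∈ vertices (facets D) → ρ v ≠ v) :
    ∃ rs : List (MvPolynomial V K), rs.length = B.card ∧
      Ideal.ofList rs = RingHom.ker (depolarization K (facets D) ρ B) ∧
      RingTheory.Sequence.IsWeaklyRegular (MvPolynomial V K ⧸ facetIdeal K D) rs := by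
  classical
  induction B using Finset.induction_on_min_value d with
  | empty => exact ⟨[], by simp [h.ker_depolarization]⟩
  | insert b B hbB hmin ih =>
    have hB' := (Finset.forall_mem_insert ..).1 hB
    obtain ⟨rs, hlen, hker, hrs⟩ := ih hB'.2
    refine ⟨rs ++ [X b - rootVariable K (facets D) ρ b], ?_, ?_, ?_⟩
    · simp [hlen, hbB]
    · rw [Ideal.ofList_append, Ideal.ofList_singleton, hker, h.ker_depolarization hB,
        h.ker_depolarization hB'.2, Finset.coe_insert, Set.image_insert_eq, Ideal.span_insert,
        sup_comm]
    · rw [isWeaklyRegular_quotient_concat_iff, hker]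
      exact ⟨hrs, h.isSMulRegular_X_sub_rootVariable hB'.2 hbB hB'.1 hmin⟩

theorem rootVariable_mem_idealOfVars (v : V) :
    rootVariable K S ρ v ∈ idealOfVars V K := by
  unfold rootVariable
  split_ifs
  · exact Ideal.subset_span ⟨_, rfl⟩
  · exact zero_mem _

theorem facetIdeal_le_idealOfVars : facetIdeal K D ≤ idealOfVars V K := by
  refine Ideal.span_le.2 (Set.image_subset_iff.2 fun H hH ↦ ?_)
  obtain ⟨v, hv⟩ := nonempty_of_mem_facets hH
  exact Ideal.mem_of_dvd _ (Finset.dvd_prod_of_mem _ hv) (Ideal.subset_span ⟨v, rfl⟩)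

theorem IsRootMap.le_depthQuotient (h : IsRootMap (facets D) ρ d)
    (hB : ∀ v ∈ B, v ∈ vertices (facets D) → ρ v ≠ v) :
    (B.card : WithBot ℕ∞) ≤ depthQuotient (facetIdeal K D) := by
  obtain ⟨rs, hlen, hker, hrs⟩ := h.exists_isWeaklyRegular (K := K) hB
  have hle : Ideal.ofList rs ≤ idealOfVars V K := by
    rw [hker, h.ker_depolarization hB, Ideal.span_le]
    rintro _ ⟨v, -, rfl⟩
    exact sub_mem (Ideal.subset_span ⟨v, rfl⟩) (rootVariable_mem_idealOfVars v)
  have hne : Ideal.ofList rs ⊔ facetIdeal K D ≠ ⊤ :=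
    ne_top_of_le_ne_top isPrime_idealOfVars.ne_top (sup_le hle facetIdeal_le_idealOfVars)
  rw [← hlen]
  exact le_iSup₂_of_le rs ⟨fun r hr ↦ hle (Ideal.subset_span hr),
    isRegular_quotient_of_sup_ne_top hrs hne⟩ le_rfl

theorem IsGrafting.isCohenMacaulayQuotient [Finite V] [DecidableEq V]
    {L : Finset (Finset V)} (h : IsGrafting (facets D) L) :
    IsCohenMacaulayQuotient (facetIdeal K D) := by
  obtain ⟨ρ, hρ, hcard⟩ := h.exists_isRootMap fun F hF ↦ nonempty_of_mem_facets (h.subset hF)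
  obtain ⟨C, hC, -⟩ := exists_minimal_isVertexCover_disjoint (S := facets D) (T := ∅)
    fun H hH hsub ↦ (nonempty_of_mem_facets hH).ne_empty (Finset.subset_empty.1 hsub)
  refine le_antisymm ((depthQuotient_facetIdeal_le hC).trans
    hC.1.le_ringKrullDim_quotient_facetIdeal) ?_
  calc ringKrullDim (MvPolynomial V K ⧸ facetIdeal K D)
      ≤ (Nat.card V - L.card : ℕ) :=
        ringKrullDim_quotient_facetIdeal_le fun C hC ↦
          h.card_le fun F hF ↦ hC F (h.subset hF)
    _ ≤ (Set.toFinite {v ∈ vertices (facets D) | ρ v = v}ᶜ).toFinset.card := by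
        rw [← Set.ncard_eq_toFinset_card, Set.ncard_compl]
        gcongr
    _ ≤ depthQuotient (facetIdeal K D) := hρ.le_depthQuotient (by simp)

end Depolarization

section SquarefreePowers

open MvPolynomial

variable {V : Type*} {S : Set (Finset V)} {F T T' : Finset V} {k : ℕ}

/-- The vertex set `T` contains `k` pairwise disjoint members of the family `S`. -/
def ContainsMatching (S : Set (Finset V)) (T : Finset V) (k : ℕ) : Prop :=
  ∃ M, IsMatching {H ∈ S | H ⊆ T} M ∧ M.card = k

theorem ContainsMatching.mono (h : ContainsMatching S T k) (hT : T ⊆ T') :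
    ContainsMatching S T' k :=
  let ⟨M, hM, hcard⟩ := h
  ⟨M, hM.mono fun _ hH ↦ ⟨hH.1, hH.2.trans hT⟩, hcard⟩

theorem IsMatching.card_filter_not_disjoint_le_one [DecidableEq V] {M : Finset (Finset V)}
    (hM : IsMatching S M) (hchain : ∀ A ∈ S, ∀ B ∈ S, F ∩ A ⊆ B ∨ F ∩ B ⊆ A) :
    {H ∈ M | ¬ Disjoint H F}.card ≤ 1 := by
  simp only [Finset.card_le_one, Finset.mem_filter, Finset.not_disjoint_iff]
  rintro A ⟨hA, a, haA, haF⟩ B ⟨hB, b, hbB, hbF⟩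
  rcases hchain A (hM.subset hA) B (hM.subset hB) with hAB | hBA
  · exact hM.eq_of_mem hA hB haA (hAB (Finset.mem_inter.2 ⟨haF, haA⟩))
  · exact hM.eq_of_mem hA hB (hBA (Finset.mem_inter.2 ⟨hbF, hbB⟩)) hbB

theorem containsMatching_union_succ_iff [DecidableEq V] (hF : F ∈ S) (hne : F.Nonempty)
    (hchain : ∀ A ∈ S, ∀ B ∈ S, F ∩ A ⊆ B ∨ F ∩ B ⊆ A) :
    ContainsMatching S (T ∪ F) (k + 1) ↔ ContainsMatching {H ∈ S | Disjoint H F} T k := by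
  refine ⟨fun ⟨M, hM, hcard⟩ ↦ ?_, fun ⟨N, hN, hcard⟩ ↦ ?_⟩
  · have hone := hM.card_filter_not_disjoint_le_one (F := F)
      fun A hA B hB ↦ hchain A hA.1 B hB.1
    have hsum := M.card_filter_add_card_filter_not (Disjoint · F)
    obtain ⟨N, hN, hNcard⟩ := Finset.exists_subset_card_eq
      (s := {H ∈ M | Disjoint H F}) (n := k) (by lia)
    refine ⟨N, ⟨fun H hH ↦ ?_, hM.pairwiseDisjoint.subset fun H hH ↦ ?_⟩, hNcard⟩
    · obtain ⟨hHM, hHF⟩ := Finset.mem_filter.1 (hN hH)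
      obtain ⟨hHS, hHT⟩ := hM.subset hHM
      exact ⟨⟨hHS, hHF⟩, hHF.left_le_of_le_sup_right hHT⟩
    · exact (Finset.mem_filter.1 (hN hH)).1
  · have hdisj (H) (hH : H ∈ N) : Disjoint H F := (hN.subset hH).1.2
    have hFN : F ∉ N := fun hFN ↦ hne.ne_empty (disjoint_self.1 (hdisj F hFN))
    refine ⟨insert F N, ⟨?_, ?_⟩, by rw [Finset.card_insert_of_notMem hFN, hcard]⟩
    · rw [Finset.coe_insert]
      exact Set.insert_subset ⟨hF, Finset.subset_union_right⟩ fun H hH ↦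
        ⟨(hN.subset hH).1.1, (hN.subset hH).2.trans Finset.subset_union_left⟩
    · rw [Finset.coe_insert, Set.pairwiseDisjoint_insert_of_notMem (by simpa using hFN)]
      exact ⟨hN.pairwiseDisjoint, fun H hH ↦ (hdisj H hH).symm⟩

theorem support_squarefreeExponent : (squarefreeExponent F).support = F := by
  classical
  ext v
  simp [squarefreeExponent_apply]

theorem pairwise_disjoint_of_sum_squarefreeExponent_le {ι : Type*} [Fintype ι] {H : ι → Finset V}
    (h : ∑ i, squarefreeExponent (H i) ≤ squarefreeExponent T) :
    Pairwise (Function.onFun Disjoint H) := by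
  classical
  intro i j hij
  refine Finset.disjoint_left.2 fun v hvi hvj ↦ ?_
  have hle := (Finset.add_le_sum (fun _ _ ↦ zero_le) (Finset.mem_univ i) (Finset.mem_univ j)
    hij).trans h v
  rw [Finsupp.add_apply, squarefreeExponent_apply, squarefreeExponent_apply,
    squarefreeExponent_apply, if_pos hvi, if_pos hvj] at hle
  split_ifs at hle <;> lia

theorem containsMatching_of_sum_squarefreeExponent_le {H : Fin k → Finset V}
    (hS : ∀ i, H i ∈ S) (hne : ∀ i, (H i).Nonempty)
    (h : ∑ i, squarefreeExponent (H i) ≤ squarefreeExponent T) : ContainsMatching S T k := by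
  have hdisj := pairwise_disjoint_of_sum_squarefreeExponent_le h
  have hinj : Function.Injective H := fun i j hij ↦ by_contra fun hne' ↦
    (hne i).ne_empty <| disjoint_self.1 <| by simpa only [Function.onFun, ← hij] using hdisj hne'
  refine ⟨Finset.univ.map ⟨H, hinj⟩, ⟨?_, ?_⟩, by simp⟩
  · rw [Finset.coe_map, Finset.coe_univ, Set.image_univ, Set.range_subset_iff]
    refine fun i ↦ ⟨hS i, ?_⟩
    rw [← support_squarefreeExponent (F := T), ← squarefreeExponent_le_iff]
    exact (Finset.single_le_sum (fun _ _ ↦ zero_le) (Finset.mem_univ i)).trans h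
  · rw [Finset.coe_map, Finset.coe_univ, Set.image_univ]
    rintro _ ⟨i, rfl⟩ _ ⟨j, rfl⟩ hij
    exact hdisj (ne_of_apply_ne H hij)

variable {K : Type*} [Field K] {D : PreAbstractSimplicialComplex V}

theorem facetIdeal_pow_eq_span :
    facetIdeal K D ^ k = Ideal.span ((fun s ↦ monomial s 1) ''
      {s | ∃ H : Fin k → Finset V, (∀ i, H i ∈ facets D) ∧ ∑ i, squarefreeExponent (H i) = s}) := by
  rw [facetIdeal, Ideal.span, Submodule.span_pow]
  congr 1
  ext p
  rw [Set.mem_pow_iff_prod]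
  constructor
  · rintro ⟨f, hf, rfl⟩
    choose H hH hHf using hf
    exact ⟨_, ⟨H, hH, rfl⟩, by simp [← hHf, monomialOf_eq_monomial, monomial_sum_one]⟩
  · rintro ⟨_, ⟨H, hH, rfl⟩, rfl⟩
    exact ⟨fun i ↦ monomialOf K (H i), fun i ↦ ⟨H i, hH i, rfl⟩,
      by simp [monomialOf_eq_monomial, monomial_sum_one]⟩

theorem monomialOf_mem_facetIdeal_pow_iff :
    monomialOf K T ∈ facetIdeal K D ^ k ↔ ContainsMatching (facets D) T k := by
  classical
  refine ⟨fun h ↦ ?_, ?_⟩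
  · rw [facetIdeal_pow_eq_span, mem_ideal_span_monomial_image] at h
    obtain ⟨_, ⟨H, hH, rfl⟩, hle⟩ := h (squarefreeExponent T) (by simp [monomialOf_eq_monomial])
    exact containsMatching_of_sum_squarefreeExponent_le hH (fun i ↦ nonempty_of_mem_facets (hH i))
      hle
  · rintro ⟨M, hM, rfl⟩
    have hprod : ∏ H ∈ M, monomialOf K H ∈ facetIdeal K D ^ M.card := by
      rw [← Finset.prod_const]
      exact Ideal.prod_mem_prod fun H hH ↦ Ideal.subset_span ⟨H, (hM.subset hH).1, rfl⟩
    have hbiUnion : ∏ H ∈ M, monomialOf K H = monomialOf K (M.biUnion id) :=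
      (Finset.prod_biUnion hM.pairwiseDisjoint).symm
    rw [hbiUnion] at hprod
    exact Ideal.mem_of_dvd _ (monomialOf_dvd_monomialOf <|
      Finset.biUnion_subset.2 fun H hH ↦ (hM.subset hH).2) hprod

theorem squarefreePower_facetIdeal_eq_span :
    squarefreePower (facetIdeal K D) k = Ideal.span ((fun s ↦ monomial s 1) ''
      (squarefreeExponent '' {T | ContainsMatching (facets D) T k})) := by
  rw [squarefreePower, Set.image_image]
  congr 1
  ext p
  simp only [← monomialOf_eq_monomial, ← monomialOf_mem_facetIdeal_pow_iff (K := K)]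
  constructor
  · rintro ⟨hp, T, rfl⟩
    exact ⟨T, hp, rfl⟩
  · rintro ⟨T, hT, rfl⟩
    exact ⟨hT, T, rfl⟩

theorem mem_squarefreePower_facetIdeal_iff {f : MvPolynomial V K} :
    f ∈ squarefreePower (facetIdeal K D) k ↔
      ∀ u ∈ f.support, ContainsMatching (facets D) u.support k := by
  rw [squarefreePower_facetIdeal_eq_span, mem_ideal_span_monomial_image]
  simp only [Set.exists_mem_image, squarefreeExponent_le_iff]
  exact forall₂_congr fun u _ ↦ ⟨fun ⟨T, hT, hTu⟩ ↦ ContainsMatching.mono hT hTu,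
    fun h ↦ ⟨_, h, subset_rfl⟩⟩

theorem mem_support_mul_monomialOf {f : MvPolynomial V K} {u : V →₀ ℕ} :
    u ∈ (f * monomialOf K F).support ↔ ∃ w ∈ f.support, w + squarefreeExponent F = u := by
  rw [monomialOf_eq_monomial, mem_support_iff, coeff_mul_monomial', mul_one]
  constructor
  · intro h
    rw [ite_ne_right_iff] at h
    exact ⟨_, mem_support_iff.2 h.2, tsub_add_cancel_of_le h.1⟩
  · rintro ⟨w, hw, rfl⟩
    simpa using hw

theorem colon_squarefreePower_facetIdeal [DecidableEq V] (hF : F ∈ facets D)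
    (hchain : ∀ A ∈ facets D, ∀ B ∈ facets D, F ∩ A ⊆ B ∨ F ∩ B ⊆ A) :
    (squarefreePower (facetIdeal K D) (k + 1)).colon {monomialOf K F} =
      squarefreePower (facetIdeal K (deleteClosedNeighborhood D F)) k := by
  have hne := nonempty_of_mem_facets hF
  ext f
  rw [Submodule.mem_colon_singleton, smul_eq_mul]
  simp only [mem_squarefreePower_facetIdeal_iff, mem_support_mul_monomialOf,
    facets_deleteClosedNeighborhood_eq_disjoint hne, forall_exists_index, and_imp,
    forall_apply_eq_imp_iff₂, Finsupp.support_add_eq_union, support_squarefreeExponent,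
    containsMatching_union_succ_iff hF hne hchain]

end SquarefreePowers

end FacetComplex

theorem lemma3p1 {V : Type*} [Fintype V] [DecidableEq V] (K : Type*) [Field K]
    (D : PreAbstractSimplicialComplex V) (hD : FacetComplex.IsCohenMacaulayForest K D)
    (F : Finset V) (hF : FacetComplex.IsLeaf D F) :
    (∀ k : ℕ, 1 ≤ k → k ≤ FacetComplex.matchingNumber D →
      (FacetComplex.squarefreePower (FacetComplex.facetIdeal K D) k).colon
          {FacetComplex.monomialOf K F} =
        FacetComplex.squarefreePower
          (FacetComplex.facetIdeal K (FacetComplex.deleteClosedNeighborhood D F)) (k - 1)) ∧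
    FacetComplex.IsCohenMacaulayForest K (FacetComplex.deleteClosedNeighborhood D F) := by
  have hne := FacetComplex.nonempty_of_mem_facets hF.1
  have hfacets := FacetComplex.facets_deleteClosedNeighborhood_eq_disjoint (D := D) hne
  obtain ⟨L, hL⟩ := hD.exists_isGrafting
  have hFL : F ∈ L := hL.mem_of_isLeafOf hF hne (FacetComplex.isAntichain_facets D)
  refine ⟨fun k hk _ ↦ ?_, ?_, ?_⟩
  · obtain ⟨k, rfl⟩ := Nat.exists_eq_add_of_le' hk
    exact FacetComplex.colon_squarefreePower_facetIdeal hF.1 (hL.chain F hFL)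
  · refine FacetComplex.HasLeaves.isForest (hD.1.hasLeaves.mono ?_)
    exact hfacets.trans_subset (Set.sep_subset _ _)
  · have hgraft := hL.erase hFL
    rw [← hfacets] at hgraft
    exact hgraft.isCohenMacaulayQuotient
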